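/- Let $\mu\in\mathbb{R}^2$, let $V=(v_{ij})\in\mathbb{R}^{2\times 2}$ be symmetric and positive definite, and let $F$ be a continuous elliptical distribution on $\mathbb{R}^2$ with symmetry center $\mu$ and shape matrix $V$, i.e. $F$ is a probability distribution with a Lebesgue density of the form $$f(x)=\det(V)^{-1/2}\,g\big((x-\mu)^T V^{-1}(x-\mu)\big)$$ for some measurable $g\ge 0$ (the elliptical generator). Assume that $F$ has a density that is bounded in a neighbourhood of $\mu$. Put $$\rho=\frac{v_{12}}{\sqrt{v_{11}v_{22}}},\qquad a=\sqrt{v_{11}/v_{22}}.$$ Let $X_1,X_2,\dots$ be i.i.d. random vectors with distribution $F$, and for each $n$ let $\hat\mu_n$ be an empirical spatial median of $X_1,\dots,X_n$, i.e. a random vector that almost surely minimizes $m\mapsto\sum_{i=1}^n\|X_i-m\|$ over $m\in\mathbb{R}^2$, where $\|\cdot\|$ is the Euclidean norm. With the spatial sign $s(x)=x/\|x\|$ for $x\ne 0$ and $s(0)=0$, let $$\hat S_n=(\hat s_{ij})=\frac1n\sum_{i=1}^n s(X_i-\hat\mu_n)\,s(X_i-\hat\mu_n)^T$$ be the empirical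 spatial sign covariance matrix, and let $$\hat\rho_n=\frac{c\,\hat s_{12}\,b}{\sqrt{(\hat s_{12}^2+b^2)^2+(\hat s_{12}\,c\,b)^2}},\qquad d=\tfrac12+\sqrt{(\hat s_{11}-\tfrac12)^2+\hat s_{12}^2},\quad c=\frac{2d-1}{d(1-d)},\quad b=d-\hat s_{11},$$ be the spatial sign correlation coefficient (a quotient with denominator $0$ is read as $0$). Then, as $n\to\infty$, 1. $\hat\rho_n\to\rho$ almost surely, and 2. $\displaystyle \sqrt n\,(\hat\rho_n-\rho)\ \xrightarrow{d}\ N\Big(0,\ (1-\rho^2)^2+\tfrac12\,(a+a^{-1})\,(1-\rho^2)^{3/2}\Big).$ In particular the asymptotic variance depends on $F$ only through $\rho$ and $a$, not through the generator $g$. -/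

import Mathlib

open MeasureTheory ProbabilityTheory Filter
open scoped ENNReal NNReal Topology Matrix

noncomputable section

namespace SpatialSign

/-- The class of continuous elliptical distributions on `ℝᵖ` with symmetry center `μ` and shape
matrix `V`: probability measures with a Lebesgue density
`x ↦ det(V)^(-1/2) g((x - μ)ᵀ V⁻¹ (x - μ))`, where `V` is symmetric positive definite and the
generator `g` is some nonnegative function. -/
structure IsElliptical {p : ℕ} (μ : EuclideanSpace ℝ (Fin p)) (V : Matrix (Fin p) (Fin p) ℝ)
    (F : Measure (EuclideanSpace ℝ (Fin p))) : Prop where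
  isProbabilityMeasure : IsProbabilityMeasure F
  posDef : V.PosDef
  exists_generator : ∃ g : ℝ → ℝ, Measurable g ∧ (∀ t, 0 ≤ g t) ∧
    F = volume.withDensity fun x => ENNReal.ofReal
      ((√V.det)⁻¹ * g ((x - μ).ofLp ⬝ᵥ (V⁻¹ *ᵥ (x - μ).ofLp)))

/-- `F` has a Lebesgue density which is bounded in a neighbourhood of the point `μ`. -/
def HasBoundedDensityAt {p : ℕ} (F : Measure (EuclideanSpace ℝ (Fin p)))
    (μ : EuclideanSpace ℝ (Fin p)) : Prop :=
  ∃ f : EuclideanSpace ℝ (Fin p) → ℝ≥0∞, Measurable f ∧ F = volume.withDensity f ∧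
    ∃ C : ℝ≥0, ∀ᶠ x in 𝓝 μ, f x ≤ C

/-- The spatial sign `x / ‖x‖`, equal to `0` at `x = 0` (where `‖x‖⁻¹ = 0`). -/
def spatialSign {p : ℕ} (x : EuclideanSpace ℝ (Fin p)) : EuclideanSpace ℝ (Fin p) :=
  ‖x‖⁻¹ • x

/-- The empirical spatial sign covariance matrix of the sample `x` with location `t`:
the average of `s(xᵢ - t) s(xᵢ - t)ᵀ`. -/
def sscm {p n : ℕ} (x : Fin n → EuclideanSpace ℝ (Fin p)) (t : EuclideanSpace ℝ (Fin p)) :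
    Matrix (Fin p) (Fin p) ℝ :=
  (n : ℝ)⁻¹ • ∑ i, Matrix.vecMulVec (spatialSign (x i - t)).ofLp (spatialSign (x i - t)).ofLp

/-- `m` is an empirical spatial median of the sample `x`: it minimizes `m ↦ ∑ᵢ ‖xᵢ - m‖`.
(It is unique unless the sample lies on a line.) -/
def IsSpatialMedian {p n : ℕ} (x : Fin n → EuclideanSpace ℝ (Fin p))
    (m : EuclideanSpace ℝ (Fin p)) : Prop :=
  ∀ m' : EuclideanSpace ℝ (Fin p), ∑ i, ‖x i - m‖ ≤ ∑ i, ‖x i - m'‖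

/-- The spatial sign correlation coefficient as a function of the entries of the (bivariate) spatial
sign covariance matrix `S`. If `s₁₂ = 0` its value is `0`, also when `b = 0`. -/
def spatialSignCorrelation (S : Matrix (Fin 2) (Fin 2) ℝ) : ℝ :=
  let d : ℝ := 1 / 2 + √((S 0 0 - 1 / 2) ^ 2 + S 0 1 ^ 2)
  let c : ℝ := (2 * d - 1) / (d * (1 - d))
  let b : ℝ := d - S 0 0
  c * S 0 1 * b / √((S 0 1 ^ 2 + b ^ 2) ^ 2 + (S 0 1 * c * b) ^ 2)

/-- The generalized correlation coefficient `v₁₂ / √(v₁₁ v₂₂)` of the shape matrix `V`. -/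
def generalizedCorrelation (V : Matrix (Fin 2) (Fin 2) ℝ) : ℝ :=
  V 0 1 / √(V 0 0 * V 1 1)

/-- The asymptotic variance `(1 - ρ²)² + ½ (a + a⁻¹) (1 - ρ²)^(3/2)`. -/
def asymptoticVariance (ρ a : ℝ) : ℝ :=
  (1 - ρ ^ 2) ^ 2 + 1 / 2 * (a + a⁻¹) * (1 - ρ ^ 2) ^ (3 / 2 : ℝ)

end SpatialSign

end

/-!
Identify the plane with `ℂ` and replace the sign `s = z / ‖z‖` by its square `s²`, which carries the
entries of `s sᵀ`. Moving the centre by `m` changes `s²` by a linear term in `m` plus a remainder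
which `‖z‖⁻¹` dominates. Under a symmetric law the linear term averages to `0`, and the spatial
median is of the order of the mean sign, so that estimating the centre only perturbs the mean of
the `s²` by `o(n^(-1/2))`.

A shear with parameter `ζ` turns an elliptical law into a rotation invariant one and acts on `s²` as
a Möbius transformation taking `0` to `ζ`. The mean value property gives `E s² = ζ` and
`E s⁴ = ζ²`, whatever the generator. In terms of `z = E s²` the correlation is
`sin (arg ((1 + z) / (1 - z)))`, and the delta method applies.
-/

open scoped ComplexConjugate RealInnerProductSpace

namespace SpatialSign

section SampleMean

variable {E F : Type*}

/-- The mean of the first `n` terms of the sequence `x`. -/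
noncomputable def sampleMean [AddCommGroup E] [Module ℝ E] (x : ℕ → E) (n : ℕ) : E :=
  (n : ℝ)⁻¹ • ∑ i ∈ Finset.range n, x i

lemma sampleMean_sub [AddCommGroup E] [Module ℝ E] (x y : ℕ → E) (n : ℕ) :
    sampleMean (fun i => x i - y i) n = sampleMean x n - sampleMean y n := by
  simp only [sampleMean, Finset.sum_sub_distrib, smul_sub]

lemma map_sampleMean [AddCommGroup E] [Module ℝ E] [AddCommGroup F] [Module ℝ F]
    {G : Type*} [FunLike G E F] [LinearMapClass G ℝ E F] (L : G) (x : ℕ → E) (n : ℕ) :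
    L (sampleMean x n) = sampleMean (fun i => L (x i)) n := by
  simp only [sampleMean, map_smul, map_sum]

lemma sampleMean_const_mul [Ring E] [Algebra ℝ E] (c : E) (x : ℕ → E) (n : ℕ) :
    sampleMean (fun i => c * x i) n = c * sampleMean x n :=
  (map_sampleMean (LinearMap.mulLeft ℝ c) x n).symm

lemma sampleMean_le_sampleMean {x y : ℕ → ℝ} (h : ∀ i, x i ≤ y i) (n : ℕ) :
    sampleMean x n ≤ sampleMean y n := by
  unfold sampleMean
  gcongr with i
  exact h i

lemma norm_sampleMean_le [NormedAddCommGroup E] [NormedSpace ℝ E] (x : ℕ → E) (n : ℕ) :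
    ‖sampleMean x n‖ ≤ sampleMean (fun i => ‖x i‖) n := by
  rw [sampleMean, sampleMean, norm_smul, Real.norm_of_nonneg (by positivity), smul_eq_mul]
  gcongr
  exact norm_sum_le _ _

end SampleMean

section Normalize

open NormedSpace

variable {E : Type*} [NormedAddCommGroup E] [NormedSpace ℝ E]

lemma norm_normalize_le_one (x : E) : ‖normalize x‖ ≤ 1 := by
  rcases eq_or_ne x 0 with rfl | hx
  · simp
  · exact (norm_normalize hx).le

lemma measurable_normalize [MeasurableSpace E] [BorelSpace E] [SecondCountableTopology E] :
    Measurable (NormedSpace.normalize : E → E) := by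
  unfold NormedSpace.normalize
  fun_prop

end Normalize

section SpatialMedian

open NormedSpace

variable {E : Type*} [NormedAddCommGroup E] [InnerProductSpace ℝ E]

lemma norm_sub_sub_norm_ge (z : E) {v : E} (hv : ‖v‖ ≤ 1) :
    (‖v‖ ^ 2 - ⟪v, normalize z⟫ ^ 2) / (2 * (1 + ‖z‖)) - ⟪v, normalize z⟫ ≤ ‖z - v‖ - ‖z‖ := by
  set q := ⟪v, normalize z⟫
  have hq : |q| ≤ ‖v‖ := by
    simpa using (abs_real_inner_le_norm v (normalize z)).trans
      (mul_le_mul_of_nonneg_left (norm_normalize_le_one z) (norm_nonneg v))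
  have hinner : ⟪z, v⟫ = ‖z‖ * q := by
    rw [← real_inner_smul_right, norm_smul_normalize, real_inner_comm]
  have hsq : ‖z - v‖ ^ 2 = (‖z‖ - q) ^ 2 + (‖v‖ ^ 2 - q ^ 2) := by
    rw [norm_sub_sq_real, hinner]
    ring
  have hq_sq : q ^ 2 ≤ ‖v‖ ^ 2 := sq_le_sq.2 (by rwa [abs_norm])
  have hle : ‖z‖ - q ≤ ‖z - v‖ := abs_le_of_sq_le_sq' (by linarith) (norm_nonneg _) |>.2
  have hsum : ‖z - v‖ + (‖z‖ - q) ≤ 2 * (1 + ‖z‖) := by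
    linarith [norm_sub_le z v, neg_le_of_abs_le hq]
  rw [sub_le_iff_le_add, div_le_iff₀ (by positivity)]
  nlinarith

lemma sampleMean_norm_sub_sub_norm_ge {z : ℕ → E} {n : ℕ} {l : ℝ} {v : E} (hv : ‖v‖ ≤ 1)
    (hcurv : l * ‖v‖ ^ 2 ≤ sampleMean
      (fun i => (‖v‖ ^ 2 - ⟪v, normalize (z i)⟫ ^ 2) / (2 * (1 + ‖z i‖))) n) :
    l * ‖v‖ ^ 2 - ‖sampleMean (fun i => normalize (z i)) n‖ * ‖v‖ ≤
      sampleMean (fun i => ‖z i - v‖ - ‖z i‖) n := by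
  have hlinear : sampleMean (fun i => ⟪v, normalize (z i)⟫) n ≤
      ‖sampleMean (fun i => normalize (z i)) n‖ * ‖v‖ := by
    rw [mul_comm]
    exact (map_sampleMean (innerₗ E v) (fun i => normalize (z i)) n).symm.trans_le
      (real_inner_le_norm _ _)
  calc _ ≤ _ := sub_le_sub hcurv hlinear
    _ ≤ sampleMean (fun i => ‖z i - v‖ - ‖z i‖) n := by
      rw [← sampleMean_sub]
      exact sampleMean_le_sampleMean (fun i => norm_sub_sub_norm_ge (z i) hv) n

lemma sampleMean_norm_sub_smul_sub_norm_nonpos {z : ℕ → E} {n : ℕ} {m : E}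
    (hm : ∑ i ∈ Finset.range n, ‖z i - m‖ ≤ ∑ i ∈ Finset.range n, ‖z i‖)
    {t : ℝ} (ht0 : 0 ≤ t) (ht1 : t ≤ 1) :
    sampleMean (fun i => ‖z i - t • m‖ - ‖z i‖) n ≤ 0 := by
  have hconvex (i : ℕ) : ‖z i - t • m‖ - ‖z i‖ ≤ t * (‖z i - m‖ - ‖z i‖) := by
    have hcomb : z i - t • m = (1 - t) • z i + t • (z i - m) := by module
    have htri := norm_add_le ((1 - t) • z i) (t • (z i - m))
    rw [← hcomb, norm_smul_of_nonneg ht0, norm_smul_of_nonneg (by linarith)] at htri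
    linarith
  refine (sampleMean_le_sampleMean hconvex n).trans ?_
  rw [sampleMean_const_mul, sampleMean, Finset.sum_sub_distrib]
  exact mul_nonpos_of_nonneg_of_nonpos ht0
    (smul_nonpos_of_nonneg_of_nonpos (by positivity) (sub_nonpos.2 hm))

lemma mul_norm_le_norm_sampleMean_normalize {z : ℕ → E} {n : ℕ} {m : E} {l : ℝ}
    (hm : ∑ i ∈ Finset.range n, ‖z i - m‖ ≤ ∑ i ∈ Finset.range n, ‖z i‖)
    (hcurv : ∀ v : E, l * ‖v‖ ^ 2 ≤ sampleMean
      (fun i => (‖v‖ ^ 2 - ⟪v, normalize (z i)⟫ ^ 2) / (2 * (1 + ‖z i‖))) n)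
    (hl : ‖sampleMean (fun i => normalize (z i)) n‖ < l) :
    l * ‖m‖ ≤ ‖sampleMean (fun i => normalize (z i)) n‖ := by
  set g := ‖sampleMean (fun i => normalize (z i)) n‖
  have hsegment {t : ℝ} (ht0 : 0 ≤ t) (ht1 : t ≤ 1) (htm : t * ‖m‖ ≤ 1) :
      l * (t * ‖m‖) ^ 2 ≤ g * (t * ‖m‖) := by
    have hnorm : ‖t • m‖ = t * ‖m‖ := norm_smul_of_nonneg ht0 m
    have hlower := sampleMean_norm_sub_sub_norm_ge (hnorm.trans_le htm) (hcurv _)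
    rw [hnorm] at hlower
    linarith [sampleMean_norm_sub_smul_sub_norm_nonpos hm ht0 ht1]
  have hm1 : ‖m‖ < 1 := by
    by_contra! h
    have hone : ‖m‖⁻¹ * ‖m‖ = 1 := inv_mul_cancel₀ (by positivity)
    have := hsegment (by positivity) (inv_le_one_of_one_le₀ h) hone.le
    rw [hone] at this
    linarith
  have hquad := hsegment zero_le_one le_rfl (by linarith)
  rw [one_mul] at hquad
  rcases (norm_nonneg m).eq_or_lt with h0 | h0
  · rw [← h0, mul_zero]
    exact norm_nonneg _
  · exact le_of_mul_le_mul_right (by linarith) h0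

end SpatialMedian

section SquaredSign

open Asymptotics

/-- The square of the spatial sign of a complex number. The value `-1` at `0` corresponds to a
spatial sign whose real part vanishes. -/
noncomputable def signSq (w : ℂ) : ℂ := if w = 0 then -1 else w / conj w

lemma signSq_of_ne_zero {w : ℂ} (hw : w ≠ 0) : signSq w = w / conj w := if_neg hw

lemma norm_signSq (w : ℂ) : ‖signSq w‖ = 1 := by
  unfold signSq
  split_ifs with h <;> simp [h]

lemma signSq_neg (w : ℂ) : signSq (-w) = signSq w := by
  simp [signSq]

lemma signSq_mul {z w : ℂ} (hz : z ≠ 0) (hw : w ≠ 0) : signSq (z * w) = signSq z * signSq w := by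
  rw [signSq_of_ne_zero hz, signSq_of_ne_zero hw, signSq_of_ne_zero (mul_ne_zero hz hw), map_mul,
    div_mul_div_comm]

lemma signSq_eq_normalize_sq {w : ℂ} (hw : w ≠ 0) : signSq w = NormedSpace.normalize w ^ 2 := by
  have hconj : conj w ≠ 0 := (map_ne_zero _).2 hw
  have hnorm : (‖w‖ : ℂ) ≠ 0 := by exact_mod_cast norm_ne_zero_iff.2 hw
  rw [signSq_of_ne_zero hw, NormedSpace.normalize, Complex.real_smul, Complex.ofReal_inv]
  field_simp
  rw [← Complex.mul_conj']

lemma measurable_signSq : Measurable signSq :=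
  Measurable.ite (measurableSet_singleton 0) measurable_const (by fun_prop)

lemma two_mul_inner_sq (v w : ℂ) : 2 * ⟪v, w⟫ ^ 2 = ‖v‖ ^ 2 * ‖w‖ ^ 2 + ⟪v ^ 2, w ^ 2⟫ := by
  rw [Complex.sq_norm, Complex.sq_norm, Complex.normSq_apply, Complex.normSq_apply]
  simp only [Complex.inner, Complex.mul_re, Complex.conj_re, Complex.conj_im, pow_two,
    Complex.mul_im]
  ring

lemma norm_signSq_one_sub_sub_le {r : ℂ} (hr : ‖r‖ ≤ 1 / 2) :
    ‖signSq (1 - r) - 1 - (conj r - r)‖ ≤ 4 * ‖r‖ ^ 2 := by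
  have hden : 1 / 2 ≤ ‖1 - conj r‖ := by
    have := norm_sub_norm_le 1 (conj r)
    rw [norm_one, RCLike.norm_conj] at this
    linarith
  have hden0 : 1 - conj r ≠ 0 := norm_pos_iff.1 (by linarith)
  have hne : 1 - r ≠ 0 := by
    rw [← map_ne_zero (starRingEnd ℂ)]
    simpa using hden0
  have hrem : signSq (1 - r) - 1 - (conj r - r) = (conj r - r) * conj r / (1 - conj r) := by
    rw [signSq_of_ne_zero hne, map_sub, map_one]
    field_simp
    ring
  have hlinear : ‖conj r - r‖ ≤ ‖r‖ + ‖r‖ := (norm_sub_le _ _).trans_eq (by rw [RCLike.norm_conj])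
  rw [hrem, norm_div, norm_mul, RCLike.norm_conj]
  calc ‖conj r - r‖ * ‖r‖ / ‖1 - conj r‖ ≤ (‖r‖ + ‖r‖) * ‖r‖ / (1 / 2) := by gcongr
    _ = 4 * ‖r‖ ^ 2 := by ring

/-- The kernel whose mean bounds the remainder when `signSq` is linearized in its centre, for
displacements of the centre up to `η`. -/
noncomputable def remKernel (η : ℝ) (z : ℂ) : ℝ := ‖z‖⁻¹ * min 1 (η * ‖z‖⁻¹)

lemma measurable_remKernel (η : ℝ) : Measurable (remKernel η) := by
  unfold remKernel
  fun_prop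

lemma norm_remKernel_le {η : ℝ} (hη : 0 ≤ η) (z : ℂ) : ‖remKernel η z‖ ≤ ‖z‖⁻¹ := by
  rw [Real.norm_of_nonneg (by unfold remKernel; positivity)]
  exact mul_le_of_le_one_right (by positivity) (min_le_left _ _)

lemma norm_signSq_sub_sub_le {z m : ℂ} (hz : z ≠ 0) {η : ℝ} (hm : ‖m‖ ≤ η) :
    ‖signSq (z - m) - signSq z - (conj m * (signSq z / conj z) - m * (signSq z / z))‖
      ≤ 12 * ‖m‖ * remKernel η z := by
  set r := m / z with hr
  have hlinear : conj m * (signSq z / conj z) - m * (signSq z / z) = signSq z * (conj r - r) := by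
    rw [hr, map_div₀]
    ring
  have hkernel : 12 * ‖r‖ * min 1 ‖r‖ ≤ 12 * ‖m‖ * remKernel η z := by
    rw [remKernel, ← mul_assoc, mul_assoc 12 ‖m‖, hr, norm_div, div_eq_mul_inv]
    gcongr
  rw [hlinear]
  refine le_trans ?_ hkernel
  rcases le_or_gt ‖r‖ (1 / 2) with hsmall | hlarge
  · have hne : 1 - r ≠ 0 := by
      refine norm_pos_iff.1 ?_
      have := norm_sub_norm_le 1 r
      rw [norm_one] at this
      linarith
    have hmul : z - m = z * (1 - r) := by
      rw [hr]
      field_simp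
    rw [hmul, signSq_mul hz hne, min_eq_right (by linarith), ← mul_sub_one, ← mul_sub, norm_mul,
      norm_signSq, one_mul]
    linarith [norm_signSq_one_sub_sub_le hsmall, sq_nonneg ‖r‖]
  · have hmin : 1 / 2 ≤ min 1 ‖r‖ := le_min (by norm_num) hlarge.le
    calc _ ≤ ‖signSq (z - m)‖ + ‖signSq z‖ + ‖signSq z * (conj r - r)‖ :=
          (norm_sub_le _ _).trans (add_le_add_left (norm_sub_le _ _) _)
      _ ≤ 1 + 1 + (‖r‖ + ‖r‖) := by
          rw [norm_mul, norm_signSq, norm_signSq, one_mul]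
          gcongr
          exact (norm_sub_le _ _).trans_eq (by rw [RCLike.norm_conj])
      _ ≤ 12 * ‖r‖ * (1 / 2) := by linarith
      _ ≤ 12 * ‖r‖ * min 1 ‖r‖ := by gcongr

lemma isLittleO_sampleMean_signSq_sub {z m : ℕ → ℂ} (hz : ∀ i, z i ≠ 0)
    (hm : Tendsto m atTop (𝓝 0))
    (hu : Tendsto (sampleMean fun i => signSq (z i) / conj (z i)) atTop (𝓝 0))
    (hv : Tendsto (sampleMean fun i => signSq (z i) / z i) atTop (𝓝 0))
    (hrem : ∀ ε > 0, ∃ η > 0, ∀ᶠ n in atTop, sampleMean (fun i => remKernel η (z i)) n ≤ ε) :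
    (fun n => sampleMean (fun i => signSq (z i - m n)) n - sampleMean (fun i => signSq (z i)) n)
      =o[atTop] m := by
  refine isLittleO_iff.2 fun δ hδ => ?_
  obtain ⟨η, hη, hker⟩ := hrem (δ / 24) (by positivity)
  have huv := (hu.norm.add hv.norm).eventually_le_const (u := δ / 2)
    (by rw [norm_zero, add_zero]; positivity)
  have hmη := hm.norm.eventually_le_const (u := η) (by rwa [norm_zero])
  filter_upwards [hker, huv, hmη] with n hker huv hmη
  have hlinear : sampleMean (fun i => conj (m n) * (signSq (z i) / conj (z i))
      - m n * (signSq (z i) / z i)) n =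
      conj (m n) * sampleMean (fun i => signSq (z i) / conj (z i)) n
        - m n * sampleMean (fun i => signSq (z i) / z i) n := by
    rw [sampleMean_sub, sampleMean_const_mul, sampleMean_const_mul]
  have hremainder := (norm_sampleMean_le (fun i => signSq (z i - m n) - signSq (z i)
    - (conj (m n) * (signSq (z i) / conj (z i)) - m n * (signSq (z i) / z i))) n).trans
    (sampleMean_le_sampleMean (fun i => norm_signSq_sub_sub_le (hz i) hmη) n)
  rw [sampleMean_sub, sampleMean_sub, hlinear, sampleMean_const_mul] at hremainder
  have htriangle := norm_le_norm_sub_add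
    (sampleMean (fun i => signSq (z i - m n)) n - sampleMean (fun i => signSq (z i)) n)
    (conj (m n) * sampleMean (fun i => signSq (z i) / conj (z i)) n
        - m n * sampleMean (fun i => signSq (z i) / z i) n)
  have hfirst := norm_sub_le (conj (m n) * sampleMean (fun i => signSq (z i) / conj (z i)) n)
    (m n * sampleMean (fun i => signSq (z i) / z i) n)
  rw [norm_mul, norm_mul, RCLike.norm_conj, ← mul_add] at hfirst
  have h1 := mul_le_mul_of_nonneg_left huv (norm_nonneg (m n))
  have h2 := mul_le_mul_of_nonneg_left hker (norm_nonneg (m n))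
  linarith

lemma isBigO_sampleMean_normalize {z m : ℕ → ℂ} (hz : ∀ i, z i ≠ 0)
    (hm : ∀ n, ∑ i ∈ Finset.range n, ‖z i - m n‖ ≤ ∑ i ∈ Finset.range n, ‖z i‖)
    (hg : Tendsto (sampleMean fun i => NormedSpace.normalize (z i)) atTop (𝓝 0))
    {a : ℝ} {c : ℂ} (hac : ‖c‖ < a)
    (ha : Tendsto (sampleMean fun i => (1 + ‖z i‖)⁻¹) atTop (𝓝 a))
    (hc : Tendsto (sampleMean fun i => (1 + ‖z i‖)⁻¹ • signSq (z i)) atTop (𝓝 c)) :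
    m =O[atTop] sampleMean fun i => NormedSpace.normalize (z i) := by
  have hl : 0 < (a - ‖c‖) / 8 := by linarith
  refine IsBigO.of_bound ((a - ‖c‖) / 8)⁻¹ ?_
  have hg' := hg.norm.eventually_lt_const (u := (a - ‖c‖) / 8) (by rwa [norm_zero])
  have hac' := (ha.sub hc.norm).eventually_const_le (u := (a - ‖c‖) / 2) (by linarith)
  filter_upwards [hg', hac'] with n hgn hacn
  rw [le_inv_mul_iff₀ hl]
  refine mul_norm_le_norm_sampleMean_normalize (hm n) (fun v => ?_) hgn
  have hterm (i : ℕ) : (‖v‖ ^ 2 - ⟪v, NormedSpace.normalize (z i)⟫ ^ 2) / (2 * (1 + ‖z i‖)) =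
      ‖v‖ ^ 2 / 4 * (1 + ‖z i‖)⁻¹ - 1 / 4 * ⟪v ^ 2, (1 + ‖z i‖)⁻¹ • signSq (z i)⟫ := by
    have := two_mul_inner_sq v (NormedSpace.normalize (z i))
    rw [NormedSpace.norm_normalize (hz i), ← signSq_eq_normalize_sq (hz i)] at this
    rw [real_inner_smul_right]
    field_simp
    linarith
  have hinner := map_sampleMean (innerₗ ℂ (v ^ 2)) (fun i => (1 + ‖z i‖)⁻¹ • signSq (z i)) n
  simp only [innerₗ_apply_apply] at hinner
  simp only [hterm, sampleMean_sub, sampleMean_const_mul, ← hinner]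
  have hle := real_inner_le_norm (v ^ 2) (sampleMean (fun i => (1 + ‖z i‖)⁻¹ • signSq (z i)) n)
  rw [norm_pow] at hle
  nlinarith [sq_nonneg ‖v‖]

end SquaredSign

section DeltaMethod

open Asymptotics

lemma isLittleO_map_sub_sub_of_hasFDerivAt {𝕜 E F G ι : Type*} [NontriviallyNormedField 𝕜]
    [NormedAddCommGroup E] [NormedSpace 𝕜 E] [NormedAddCommGroup F] [NormedSpace 𝕜 F]
    [NormedAddCommGroup G] {l : Filter ι} {Φ : E → F} {L : E →L[𝕜] F} {ζ : E}
    (hΦ : HasFDerivAt Φ L ζ) {x y : ι → E} {g : ι → G} (hy : Tendsto y l (𝓝 ζ))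
    (hxy : (fun i => y i - x i) =o[l] g) :
    (fun i => Φ (y i) - Φ ζ - L (x i - ζ)) =o[l] fun i => (g i, x i - ζ) := by
  have hg : g =O[l] fun i => (g i, x i - ζ) := isBigO_fst_prod
  have hx : (fun i => x i - ζ) =O[l] fun i => (g i, x i - ζ) := isBigO_snd_prod
  have hyζ : (fun i => y i - ζ) =O[l] fun i => (g i, x i - ζ) :=
    ((hxy.isBigO.trans hg).add hx).congr_left fun i => sub_add_sub_cancel _ _ _
  have htaylor := (hΦ.isLittleO.comp_tendsto hy).trans_isBigO hyζ
  have hlinear := ((L.isBigO_comp (fun i => y i - x i) l).trans_isLittleO hxy).trans_isBigO hg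
  refine (htaylor.add hlinear).congr_left fun i => ?_
  simp only [Function.comp_apply, map_sub]
  abel

end DeltaMethod

section Probability

open Asymptotics

variable {Ω : Type*} [MeasurableSpace Ω] {P : Measure Ω}

lemma tendstoInMeasure_zero_of_isLittleO [IsFiniteMeasure P] {E F : Type*} [NormedAddCommGroup E]
    [MeasurableSpace E] [OpensMeasurableSpace E] [NormedAddCommGroup F] [MeasurableSpace F]
    [OpensMeasurableSpace F] {D : ℕ → Ω → E} {B : ℕ → Ω → F}
    (hD : ∀ n, AEMeasurable (D n) P) (hB : ∀ n, AEMeasurable (B n) P)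
    (htight : IsTightMeasureSet (Set.range fun n => P.map (B n)))
    (h : ∀ᵐ ω ∂P, (fun n => D n ω) =o[atTop] fun n => B n ω) :
    TendstoInMeasure P D atTop 0 := by
  set R : ℕ → Ω → ℝ := fun n ω => ‖D n ω‖ / (1 + ‖B n ω‖) with hR
  have hR0 : TendstoInMeasure P R atTop 0 := by
    refine tendstoInMeasure_of_tendsto_ae (fun n =>
      ((hD n).norm.div ((hB n).norm.const_add 1)).aestronglyMeasurable) ?_
    filter_upwards [h] with ω hω
    have hle : (fun n => B n ω) =O[atTop] fun n => 1 + ‖B n ω‖ := .of_norm_le fun n =>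
      le_add_of_nonneg_left zero_le_one
    exact (hω.trans_isBigO hle).norm_left.tendsto_div_nhds_zero
  rw [tendstoInMeasure_iff_norm] at hR0 ⊢
  intro ε hε
  rw [ENNReal.tendsto_nhds_zero]
  intro r hr
  have hBr := (tendsto_measure_norm_gt_of_isTightMeasureSet htight).eventually
    (ge_mem_nhds (ENNReal.half_pos hr.ne'))
  obtain ⟨M, hM, hM0⟩ := (hBr.and (eventually_ge_atTop 0)).exists
  have hε' : 0 < ε / (1 + M) := by positivity
  filter_upwards [(hR0 _ hε').eventually (ge_mem_nhds (ENNReal.half_pos hr.ne'))] with n hn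
  have hsub : {ω | ε ≤ ‖D n ω - (0 : Ω → E) ω‖} ⊆
      {ω | M < ‖B n ω‖} ∪ {ω | ε / (1 + M) ≤ ‖R n ω - (0 : Ω → ℝ) ω‖} := by
    intro ω hω
    refine or_iff_not_imp_left.2 fun hBM => ?_
    simp only [Set.mem_ofPred_eq, not_lt, Pi.zero_apply, sub_zero, hR] at hω hBM ⊢
    rw [Real.norm_of_nonneg (by positivity)]
    gcongr
  have hBn : P {ω | M < ‖B n ω‖} ≤ r / 2 := by
    rw [iSup_range] at hM
    refine (le_iSup (fun n => P.map (B n) {x | M < ‖x‖}) n |>.trans hM).trans' ?_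
    exact (Measure.map_apply_of_aemeasurable (hB n)
      (measurableSet_lt measurable_const measurable_norm)).ge
  calc P {ω | ε ≤ ‖D n ω - (0 : Ω → E) ω‖}
      ≤ r / 2 + r / 2 := (measure_mono hsub).trans <| (measure_union_le _ _).trans <|
        add_le_add hBn hn
    _ = r := ENNReal.add_halves r

lemma isTightMeasureSet_range_map_of_tendstoInDistribution [IsProbabilityMeasure P] {E : Type*}
    [NormedAddCommGroup E] [CompleteSpace E] [SecondCountableTopology E] [MeasurableSpace E]
    [BorelSpace E] {Ω' : Type*} [MeasurableSpace Ω'] {P' : Measure Ω'} [IsProbabilityMeasure P']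
    {X : ℕ → Ω → E} {Y : Ω' → E} (h : TendstoInDistribution X atTop Y (fun _ => P) P') :
    IsTightMeasureSet (Set.range fun n => P.map (X n)) := by
  have hcompact := h.tendsto.isCompact_insert_range
  rw [← hcompact.isClosed.closure_eq] at hcompact
  refine (isTightMeasureSet_of_isCompact_closure hcompact).subset ?_
  rintro _ ⟨n, rfl⟩
  exact ⟨_, Set.mem_insert_of_mem _ ⟨n, rfl⟩, rfl⟩

lemma isTightMeasureSet_range_map_prodMk {E F : Type*} [TopologicalSpace E] [MeasurableSpace E]
    [TopologicalSpace F] [MeasurableSpace F] {X : ℕ → Ω → E}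
    {Y : ℕ → Ω → F} (hX : ∀ n, AEMeasurable (X n) P) (hY : ∀ n, AEMeasurable (Y n) P)
    (hXt : IsTightMeasureSet (Set.range fun n => P.map (X n)))
    (hYt : IsTightMeasureSet (Set.range fun n => P.map (Y n))) :
    IsTightMeasureSet (Set.range fun n => P.map fun ω => (X n ω, Y n ω)) := by
  refine .prodMk (hXt.subset ?_) (hYt.subset ?_)
  · rintro _ ⟨_, ⟨n, rfl⟩, rfl⟩
    exact ⟨n, (Measure.fst_map_prodMk₀ (hY n)).symm⟩
  · rintro _ ⟨_, ⟨n, rfl⟩, rfl⟩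
    exact ⟨n, (Measure.snd_map_prodMk₀ (hX n)).symm⟩

lemma aemeasurable_sampleMean {E : Type*} [NormedAddCommGroup E] [NormedSpace ℝ E]
    [MeasurableSpace E] [BorelSpace E] [SecondCountableTopology E] {Y : ℕ → Ω → E}
    (hY : ∀ i, AEMeasurable (Y i) P) (n : ℕ) :
    AEMeasurable (fun ω => sampleMean (fun i => Y i ω) n) P := by
  unfold sampleMean
  fun_prop

end Probability

section IndependentSample

variable {Ω 𝓧 : Type*} [MeasurableSpace Ω] [MeasurableSpace 𝓧] {P : Measure Ω}
  {ν : Measure 𝓧} {Z : ℕ → Ω → 𝓧}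

lemma identDistrib_comp_of_hasLaw (hlaw : ∀ i, HasLaw (Z i) ν P) {E : Type*} [MeasurableSpace E]
    {f : 𝓧 → E} (hf : Measurable f) (i j : ℕ) :
    IdentDistrib (fun ω => f (Z i ω)) (fun ω => f (Z j ω)) P P :=
  .comp ⟨(hlaw i).aemeasurable, (hlaw j).aemeasurable, by rw [(hlaw i).map_eq, (hlaw j).map_eq]⟩ hf

lemma ae_tendsto_sampleMean (hlaw : ∀ i, HasLaw (Z i) ν P) (hind : iIndepFun Z P)
    {E : Type*} [NormedAddCommGroup E] [NormedSpace ℝ E] [CompleteSpace E] [MeasurableSpace E]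
    [BorelSpace E] [SecondCountableTopology E] {f : 𝓧 → E} (hf : Measurable f)
    (hint : Integrable f ν) :
    ∀ᵐ ω ∂P, Tendsto (sampleMean fun i => f (Z i ω)) atTop (𝓝 (∫ z, f z ∂ν)) := by
  rw [← (hlaw 0).integral_comp hf.aestronglyMeasurable]
  rw [← (hlaw 0).map_eq] at hint
  exact strong_law_ae (fun i ω => f (Z i ω)) (hint.comp_aemeasurable (hlaw 0).aemeasurable)
    (fun i j hij => (hind.indepFun hij).comp hf hf)
    fun i => identDistrib_comp_of_hasLaw hlaw hf i 0

variable [IsProbabilityMeasure P]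

lemma tendstoInDistribution_sqrt_mul_sampleMean_sub (hlaw : ∀ i, HasLaw (Z i) ν P)
    (hind : iIndepFun Z P) {f : 𝓧 → ℝ} (hf : Measurable f) (hf2 : MemLp f 2 ν) :
    TendstoInDistribution
      (fun (n : ℕ) ω => √(n : ℝ) * (sampleMean (fun i => f (Z i ω)) n - ∫ z, f z ∂ν)) atTop
      (id : ℝ → ℝ) (fun _ => P) (gaussianReal 0 Var[f; ν].toNNReal) := by
  have hvar : Var[fun ω => f (Z 0 ω); P] = Var[f; ν] := by
    rw [← (hlaw 0).map_eq]
    exact (variance_map hf.aemeasurable (hlaw 0).aemeasurable).symm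
  rw [← hvar, ← (hlaw 0).integral_comp hf.aestronglyMeasurable]
  rw [← (hlaw 0).map_eq] at hf2
  have hclt := tendstoInDistribution_inv_sqrt_mul_sum_sub (X := fun i ω => f (Z i ω))
    HasLaw.id (hf2.comp_of_map (hlaw 0).aemeasurable) (hind.comp (fun _ => f) fun _ => hf)
    fun i => identDistrib_comp_of_hasLaw hlaw hf i 0
  refine hclt.congr (fun n => .of_forall fun ω => ?_) .rfl
  rcases eq_or_ne n 0 with rfl | hn
  · simp [sampleMean]
  have hn' : (n : ℝ) ≠ 0 := Nat.cast_ne_zero.2 hn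
  simp only [sampleMean, smul_eq_mul, Function.comp_def]
  rw [← Real.sqrt_div_self, div_mul_eq_mul_div, mul_div_assoc, sub_div,
    mul_div_cancel_left₀ _ hn', inv_mul_eq_div]

lemma isTightMeasureSet_sqrt_smul_sampleMean_sub (hlaw : ∀ i, HasLaw (Z i) ν P)
    (hind : iIndepFun Z P) [IsFiniteMeasure ν] {E : Type*} [NormedAddCommGroup E]
    [InnerProductSpace ℝ E] [FiniteDimensional ℝ E] [MeasurableSpace E] [BorelSpace E]
    {f : 𝓧 → E} (hf : Measurable f) (hf2 : MemLp f 2 ν) :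
    IsTightMeasureSet (Set.range fun n : ℕ =>
      P.map fun ω => √(n : ℝ) • (sampleMean (fun i => f (Z i ω)) n - ∫ z, f z ∂ν)) := by
  have hmeas : ∀ n : ℕ, AEMeasurable
      (fun ω => √(n : ℝ) • (sampleMean (fun i => f (Z i ω)) n - ∫ z, f z ∂ν)) P := fun n =>
    ((aemeasurable_sampleMean (fun i => hf.comp_aemeasurable (hlaw i).aemeasurable) n).sub_const
      _).const_smul _
  have := FiniteDimensional.complete ℝ E
  have hfint : Integrable f ν := hf2.integrable (by norm_num)
  refine isTightMeasureSet_range_of_tendsto_limsup_inner ℝ fun y => ?_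
  have hclt := tendstoInDistribution_sqrt_mul_sampleMean_sub hlaw hind
    (measurable_const.inner hf) (hf2.const_inner (𝕜 := ℝ) y)
  have htight := isTightMeasureSet_range_iff_tendsto_limsup_measure_norm_gt.1
    (isTightMeasureSet_range_map_of_tendstoInDistribution hclt)
  refine htight.congr fun r => limsup_congr (.of_forall fun n => ?_)
  rw [Measure.map_apply_of_aemeasurable (hmeas n) (by measurability),
    Measure.map_apply_of_aemeasurable (hclt.forall_aemeasurable n) (by measurability)]
  congr 1 with ω
  simp only [Set.mem_preimage, Set.mem_ofPred_eq, real_inner_smul_right, inner_sub_right,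
    integral_inner hfint]
  rw [← innerSL_apply_apply ℝ y (sampleMean _ n), map_sampleMean]
  rfl

end IndependentSample

section Law

variable {𝓧 : Type*} [MeasurableSpace 𝓧]

lemma integral_eq_zero_of_forall_neg [AddGroup 𝓧] [MeasurableNeg 𝓧] {ν : Measure 𝓧}
    [ν.IsNegInvariant] {E : Type*} [NormedAddCommGroup E] [NormedSpace ℝ E] {f : 𝓧 → E}
    (hf : ∀ z, f (-z) = -f z) : ∫ z, f z ∂ν = 0 := by
  have h := integral_neg_eq_self f ν
  simp only [hf, integral_neg] at h
  have : IsAddTorsionFree E := .of_isTorsionFree ℝ E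
  exact neg_eq_self.1 h

lemma norm_integral_smul_lt_integral {ν : Measure 𝓧} [IsProbabilityMeasure ν] {E : Type*}
    [NormedAddCommGroup E] [NormedSpace ℝ E] [CompleteSpace E] [StrictConvexSpace ℝ E] {w : 𝓧 → ℝ}
    {u : 𝓧 → E} (hw : ∀ x, 0 < w x) (hwint : Integrable w ν) (hu : ∀ x, ‖u x‖ ≤ 1)
    (hlt : ‖∫ x, u x ∂ν‖ < 1) :
    ‖∫ x, w x • u x ∂ν‖ < ∫ x, w x ∂ν := by
  have hwm : AEMeasurable (fun x => ENNReal.ofReal (w x)) ν := hwint.aemeasurable.ennreal_ofReal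
  have hfin : IsFiniteMeasure (ν.withDensity fun x => ENNReal.ofReal (w x)) :=
    isFiniteMeasure_withDensity_ofReal hwint.2
  have htotal : (ν.withDensity fun x => ENNReal.ofReal (w x)).real Set.univ = ∫ x, w x ∂ν := by
    rw [measureReal_def, withDensity_apply _ .univ, Measure.restrict_univ,
      integral_eq_lintegral_of_nonneg_ae (.of_forall fun x => (hw x).le) hwint.1]
  have hint : ∫ x, u x ∂ν.withDensity (fun x => ENNReal.ofReal (w x)) = ∫ x, w x • u x ∂ν := by
    rw [integral_withDensity_eq_integral_toReal_smul₀ hwm (.of_forall fun x => by simp)]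
    simp only [ENNReal.toReal_ofReal (hw _).le]
  have hcases := ae_eq_const_or_norm_integral_lt_of_norm_le_const (f := u) (C := 1)
    (μ := ν.withDensity fun x => ENNReal.ofReal (w x)) (.of_forall hu)
  rw [htotal, hint, mul_one] at hcases
  rcases hcases with hconst | hlt'
  · obtain ⟨κ, hκ⟩ : ∃ κ, ∀ᵐ x ∂ν, u x = κ :=
      ⟨_, ((ae_withDensity_iff' hwm).1 hconst).mono fun x hx =>
        hx (ENNReal.ofReal_pos.2 (hw x)).ne'⟩
    have hpos : 0 < ∫ x, w x ∂ν := (integral_pos_iff_support_of_nonneg (fun x => (hw x).le)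
      hwint).2 (by simp [Function.support, (hw _).ne'])
    have hint_u : ∫ x, u x ∂ν = κ := by
      rw [integral_congr_ae hκ, integral_const, probReal_univ, one_smul]
    have hint_wu : ∫ x, w x • u x ∂ν = (∫ x, w x ∂ν) • κ := by
      rw [← integral_smul_const]
      exact integral_congr_ae (hκ.mono fun x hx => congrArg (w x • ·) hx)
    rw [hint_wu, norm_smul, Real.norm_of_nonneg hpos.le]
    exact mul_lt_of_lt_one_right hpos (hint_u ▸ hlt)
  · exact hlt'

lemma tendsto_integral_remKernel {ν : Measure ℂ} (hinv : Integrable (fun z => ‖z‖⁻¹) ν) :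
    Tendsto (fun η => ∫ z, remKernel η z ∂ν) (𝓝[>] 0) (𝓝 0) := by
  have hzero (z : ℂ) : remKernel 0 z = 0 := by simp [remKernel]
  have hlim : Tendsto (fun η => ∫ z, remKernel η z ∂ν) (𝓝[>] 0) (𝓝 (∫ z, remKernel 0 z ∂ν)) :=
    tendsto_integral_filter_of_dominated_convergence (fun z => ‖z‖⁻¹)
      (.of_forall fun η => (measurable_remKernel η).aestronglyMeasurable)
      (eventually_mem_nhdsWithin.mono fun η hη => .of_forall (norm_remKernel_le (le_of_lt hη))) hinv
      (.of_forall fun z => Continuous.tendsto (by unfold remKernel; fun_prop) 0 |>.mono_left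
        nhdsWithin_le_nhds)
  simpa only [hzero, integral_zero] using hlim

lemma variance_inner_of_norm_eq_one {ν : Measure 𝓧} [IsProbabilityMeasure ν] {u : 𝓧 → ℂ}
    (hum : Measurable u) (hu : ∀ x, ‖u x‖ = 1)
    (hsq : ∫ x, u x ^ 2 ∂ν = (∫ x, u x ∂ν) ^ 2) (v : ℂ) :
    Var[fun x => ⟪v, u x⟫; ν] = ‖v‖ ^ 2 * (1 - ‖∫ x, u x ∂ν‖ ^ 2) / 2 := by
  have hint : Integrable u ν := .of_bound hum.aestronglyMeasurable 1 (.of_forall fun x => (hu x).le)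
  have hint_sq : Integrable (fun x => u x ^ 2) ν :=
    .of_bound (hum.pow_const 2).aestronglyMeasurable 1 (.of_forall fun x => by simp [hu])
  have hmem : MemLp (fun x => ⟪v, u x⟫) 2 ν :=
    (MemLp.of_bound hum.aestronglyMeasurable 1 (.of_forall fun x => (hu x).le)).const_inner v
  have hpoint (x : 𝓧) : ⟪v, u x⟫ ^ 2 = (‖v‖ ^ 2 + ⟪v ^ 2, u x ^ 2⟫) / 2 := by
    rw [eq_div_iff two_ne_zero, mul_comm, two_mul_inner_sq, hu, one_pow, mul_one]
  have hmoment : ∫ x, ⟪v, u x⟫ ^ 2 ∂ν = (‖v‖ ^ 2 + ⟪v ^ 2, (∫ x, u x ∂ν) ^ 2⟫) / 2 := by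
    simp only [hpoint]
    rw [integral_div, integral_add (integrable_const _) (hint_sq.const_inner _),
      integral_inner hint_sq, hsq, integral_const, probReal_univ, one_smul]
  rw [variance_eq_sub hmem, integral_inner hint]
  simp only [Pi.pow_apply, hmoment]
  linarith [two_mul_inner_sq v (∫ x, u x ∂ν)]

end Law

section MedianCentring

open Asymptotics

variable {Ω : Type*} [MeasurableSpace Ω] {P : Measure Ω} {ν : Measure ℂ} {Z T : ℕ → Ω → ℂ}

lemma memLp_normalize [IsFiniteMeasure ν] (p : ℝ≥0∞) :
    MemLp (NormedSpace.normalize : ℂ → ℂ) p ν :=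
  .of_bound measurable_normalize.aestronglyMeasurable 1 (.of_forall norm_normalize_le_one)

lemma memLp_signSq [IsFiniteMeasure ν] (p : ℝ≥0∞) : MemLp signSq p ν :=
  .of_bound measurable_signSq.aestronglyMeasurable 1 (.of_forall fun z => (norm_signSq z).le)

lemma ae_forall_ne_zero (hlaw : ∀ i, HasLaw (Z i) ν P) (h0 : ∀ᵐ z ∂ν, z ≠ 0) :
    ∀ᵐ ω ∂P, ∀ i, Z i ω ≠ 0 :=
  ae_all_iff.2 fun i => ae_of_ae_map (hlaw i).aemeasurable ((hlaw i).map_eq.symm ▸ h0)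

variable [ν.IsNegInvariant]

lemma ae_isLittleO_sampleMean_signSq_sub (hlaw : ∀ i, HasLaw (Z i) ν P) (hind : iIndepFun Z P)
    (h0 : ∀ᵐ z ∂ν, z ≠ 0) (hinv : Integrable (fun z => ‖z‖⁻¹) ν) :
    ∀ᵐ ω ∂P, ∀ m : ℕ → ℂ, Tendsto m atTop (𝓝 0) →
      (fun n => sampleMean (fun i => signSq (Z i ω - m n)) n
        - sampleMean (fun i => signSq (Z i ω)) n) =o[atTop] m := by
  have hum : Measurable fun z : ℂ => signSq z / conj z :=
    measurable_signSq.div (by fun_prop)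
  have hvm : Measurable fun z : ℂ => signSq z / z := measurable_signSq.div measurable_id
  have hu := ae_tendsto_sampleMean hlaw hind hum
    (hinv.mono' hum.aestronglyMeasurable (.of_forall fun z => by simp [norm_signSq]))
  have hv := ae_tendsto_sampleMean hlaw hind hvm
    (hinv.mono' hvm.aestronglyMeasurable (.of_forall fun z => by simp [norm_signSq]))
  rw [integral_eq_zero_of_forall_neg fun z => by simp [signSq_neg, div_neg]] at hu hv
  have hker : ∀ᵐ ω ∂P, ∀ k : ℕ, Tendsto
      (sampleMean fun i => remKernel (1 / ((k : ℝ) + 1)) (Z i ω)) atTop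
      (𝓝 (∫ z, remKernel (1 / ((k : ℝ) + 1)) z ∂ν)) :=
    ae_all_iff.2 fun k => ae_tendsto_sampleMean hlaw hind (measurable_remKernel _)
      (hinv.mono' (measurable_remKernel _).aestronglyMeasurable
        (.of_forall (norm_remKernel_le (by positivity))))
  have hker0 := (tendsto_integral_remKernel hinv).comp
    (tendsto_nhdsWithin_iff.2 ⟨tendsto_one_div_add_atTop_nhds_zero_nat (𝕜 := ℝ),
      .of_forall fun k => Set.mem_Ioi.2 Nat.one_div_pos_of_nat⟩)
  filter_upwards [ae_forall_ne_zero hlaw h0, hu, hv, hker] with ω hz hu hv hker m hm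
  refine isLittleO_sampleMean_signSq_sub hz hm hu hv fun ε hε => ?_
  obtain ⟨k, hk⟩ := (hker0.eventually_lt_const hε).exists
  exact ⟨1 / ((k : ℝ) + 1), Nat.one_div_pos_of_nat, (hker k).eventually_le_const hk⟩

variable [IsProbabilityMeasure ν]

lemma ae_tendsto_sampleMean_normalize (hlaw : ∀ i, HasLaw (Z i) ν P) (hind : iIndepFun Z P) :
    ∀ᵐ ω ∂P, Tendsto (sampleMean fun i => NormedSpace.normalize (Z i ω)) atTop (𝓝 0) := by
  have hmean := ae_tendsto_sampleMean hlaw hind measurable_normalize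
    ((memLp_normalize 1).integrable le_rfl)
  rwa [integral_eq_zero_of_forall_neg NormedSpace.normalize_neg] at hmean

lemma ae_isBigO_median (hlaw : ∀ i, HasLaw (Z i) ν P) (hind : iIndepFun Z P)
    (h0 : ∀ᵐ z ∂ν, z ≠ 0) (hlt : ‖∫ z, signSq z ∂ν‖ < 1)
    (hT : ∀ n, ∀ᵐ ω ∂P,
      ∑ i ∈ Finset.range n, ‖Z i ω - T n ω‖ ≤ ∑ i ∈ Finset.range n, ‖Z i ω‖) :
    ∀ᵐ ω ∂P, (T · ω) =O[atTop] sampleMean fun i => NormedSpace.normalize (Z i ω) := by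
  have hw0 (z : ℂ) : 0 < (1 + ‖z‖)⁻¹ := by positivity
  have hw1 (z : ℂ) : ‖(1 + ‖z‖)⁻¹‖ ≤ 1 := by
    rw [Real.norm_of_nonneg (hw0 z).le]
    exact inv_le_one_of_one_le₀ (by linarith [norm_nonneg z])
  have hwm : Measurable fun z : ℂ => (1 + ‖z‖)⁻¹ := by fun_prop
  have hw : Integrable (fun z => (1 + ‖z‖)⁻¹) ν :=
    .of_bound hwm.aestronglyMeasurable 1 (.of_forall hw1)
  have hws : Integrable (fun z => (1 + ‖z‖)⁻¹ • signSq z) ν :=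
    .of_bound (hwm.smul measurable_signSq).aestronglyMeasurable 1 (.of_forall fun z => by
      rw [norm_smul, norm_signSq, mul_one]
      exact hw1 z)
  filter_upwards [ae_forall_ne_zero hlaw h0, ae_all_iff.2 hT,
    ae_tendsto_sampleMean_normalize hlaw hind, ae_tendsto_sampleMean hlaw hind hwm hw,
    ae_tendsto_sampleMean hlaw hind (hwm.smul measurable_signSq) hws] with ω hz hT hg ha hc
  exact isBigO_sampleMean_normalize hz hT hg
    (norm_integral_smul_lt_integral hw0 hw (fun z => (norm_signSq z).le) hlt) ha hc

lemma ae_isLittleO_sampleMean_signSq_sub_median (hlaw : ∀ i, HasLaw (Z i) ν P)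
    (hind : iIndepFun Z P) (h0 : ∀ᵐ z ∂ν, z ≠ 0) (hinv : Integrable (fun z => ‖z‖⁻¹) ν)
    (hlt : ‖∫ z, signSq z ∂ν‖ < 1)
    (hT : ∀ n, ∀ᵐ ω ∂P,
      ∑ i ∈ Finset.range n, ‖Z i ω - T n ω‖ ≤ ∑ i ∈ Finset.range n, ‖Z i ω‖) :
    ∀ᵐ ω ∂P, (fun n => sampleMean (fun i => signSq (Z i ω - T n ω)) n
      - sampleMean (fun i => signSq (Z i ω)) n)
        =o[atTop] sampleMean fun i => NormedSpace.normalize (Z i ω) := by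
  filter_upwards [ae_isBigO_median hlaw hind h0 hlt hT,
    ae_isLittleO_sampleMean_signSq_sub hlaw hind h0 hinv,
    ae_tendsto_sampleMean_normalize hlaw hind] with ω hbigO hlittleO hg
  exact (hlittleO _ (hbigO.trans_tendsto hg)).trans_isBigO hbigO

lemma ae_tendsto_sampleMean_signSq_sub_median (hlaw : ∀ i, HasLaw (Z i) ν P)
    (hind : iIndepFun Z P) (h0 : ∀ᵐ z ∂ν, z ≠ 0) (hinv : Integrable (fun z => ‖z‖⁻¹) ν)
    (hlt : ‖∫ z, signSq z ∂ν‖ < 1)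
    (hT : ∀ n, ∀ᵐ ω ∂P,
      ∑ i ∈ Finset.range n, ‖Z i ω - T n ω‖ ≤ ∑ i ∈ Finset.range n, ‖Z i ω‖) :
    ∀ᵐ ω ∂P, Tendsto (fun n => sampleMean (fun i => signSq (Z i ω - T n ω)) n) atTop
      (𝓝 (∫ z, signSq z ∂ν)) := by
  have hmean := ae_tendsto_sampleMean hlaw hind measurable_signSq
    ((memLp_signSq 1).integrable le_rfl)
  filter_upwards [ae_isLittleO_sampleMean_signSq_sub_median hlaw hind h0 hinv hlt hT,
    ae_tendsto_sampleMean_normalize hlaw hind, hmean] with ω hlittleO hg hs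
  simpa using (hlittleO.isBigO.trans_tendsto hg).add hs

theorem tendstoInDistribution_sqrt_mul_sub_of_hasGradientAt [IsProbabilityMeasure P]
    (hlaw : ∀ i, HasLaw (Z i) ν P) (hind : iIndepFun Z P) (h0 : ∀ᵐ z ∂ν, z ≠ 0)
    (hinv : Integrable (fun z => ‖z‖⁻¹) ν) (hlt : ‖∫ z, signSq z ∂ν‖ < 1)
    (hTm : ∀ n, AEMeasurable (T n) P)
    (hT : ∀ n, ∀ᵐ ω ∂P,
      ∑ i ∈ Finset.range n, ‖Z i ω - T n ω‖ ≤ ∑ i ∈ Finset.range n, ‖Z i ω‖)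
    {Φ : ℂ → ℝ} (hΦm : Measurable Φ) {v : ℂ} (hΦ : HasGradientAt Φ v (∫ z, signSq z ∂ν)) :
    TendstoInDistribution (fun (n : ℕ) ω => √(n : ℝ) *
      (Φ (sampleMean (fun i => signSq (Z i ω - T n ω)) n) - Φ (∫ z, signSq z ∂ν))) atTop
      (id : ℝ → ℝ) (fun _ => P) (gaussianReal 0 Var[fun z => ⟪v, signSq z⟫; ν].toNNReal) := by
  have hclt := tendstoInDistribution_sqrt_mul_sampleMean_sub hlaw hind
    (measurable_const.inner measurable_signSq) ((memLp_signSq 2).const_inner (𝕜 := ℝ) v)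
  have hstat (n : ℕ) : AEMeasurable (fun ω => √(n : ℝ) *
      (Φ (sampleMean (fun i => signSq (Z i ω - T n ω)) n) - Φ (∫ z, signSq z ∂ν))) P :=
    ((hΦm.comp_aemeasurable (aemeasurable_sampleMean (fun i => measurable_signSq.comp_aemeasurable
      ((hlaw i).aemeasurable.sub (hTm n))) n)).sub_const _).const_mul _
  have hscaled {f : ℂ → ℂ} (hf : Measurable f) (n : ℕ) : AEMeasurable
      (fun ω => √(n : ℝ) • (sampleMean (fun i => f (Z i ω)) n - ∫ z, f z ∂ν)) P :=
    ((aemeasurable_sampleMean (fun i => hf.comp_aemeasurable (hlaw i).aemeasurable) n).sub_const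
      (∫ z, f z ∂ν)).const_smul √(n : ℝ)
  have htight := isTightMeasureSet_range_map_prodMk (hscaled measurable_normalize)
    (hscaled measurable_signSq)
    (isTightMeasureSet_sqrt_smul_sampleMean_sub hlaw hind measurable_normalize
      (memLp_normalize 2))
    (isTightMeasureSet_sqrt_smul_sampleMean_sub hlaw hind measurable_signSq (memLp_signSq 2))
  refine tendstoInDistribution_of_tendstoInMeasure_sub _ _ hclt ?_ hstat
  refine tendstoInMeasure_zero_of_isLittleO (fun n => (hstat n).sub (hclt.forall_aemeasurable n))
    (fun n => (hscaled measurable_normalize n).prodMk (hscaled measurable_signSq n)) htight ?_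
  filter_upwards [ae_isLittleO_sampleMean_signSq_sub_median hlaw hind h0 hinv hlt hT,
    ae_tendsto_sampleMean_signSq_sub_median hlaw hind h0 hinv hlt hT] with ω hlittleO hlim
  refine ((isBigO_refl (fun n : ℕ => √(n : ℝ)) atTop).smul_isLittleO
    (isLittleO_map_sub_sub_of_hasFDerivAt hΦ hlim hlittleO)).congr (fun n => ?_) fun n => ?_
  · simp only [InnerProductSpace.toDual_apply_apply, inner_sub_right, smul_eq_mul, Pi.sub_apply,
      integral_inner ((memLp_signSq 2).integrable one_le_two), mul_sub]
    rw [← innerSL_apply_apply ℝ v (sampleMean _ n), map_sampleMean]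
    simp
  · rw [integral_eq_zero_of_forall_neg NormedSpace.normalize_neg, sub_zero]
    rfl

end MedianCentring

section InverseMoment

lemma integrableAtFilter_withDensity {α E : Type*} [MeasurableSpace α] [NormedAddCommGroup E]
    {m : Measure α} {l : Filter α} [l.IsMeasurablyGenerated] {h : α → E}
    (hh : IntegrableAtFilter h l m) {f : α → ℝ≥0∞} {C : ℝ≥0} (hf : ∀ᶠ x in l, f x ≤ C) :
    IntegrableAtFilter h l (m.withDensity f) := by
  obtain ⟨s, hs, hint⟩ := hh
  obtain ⟨t, ht, htm, hsub⟩ :=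
    IsMeasurablyGenerated.exists_measurable_subset (inter_mem hs hf)
  have hle : (m.withDensity f).restrict t ≤ C • m.restrict t := calc
    (m.withDensity f).restrict t = (m.restrict t).withDensity f := restrict_withDensity htm f
    _ ≤ (m.restrict t).withDensity fun _ => C :=
      withDensity_mono ((ae_restrict_mem htm).mono fun x hx => (hsub hx).2)
    _ = C • m.restrict t := withDensity_const _
  exact ⟨t, ht, ((hint.mono_set fun x hx => (hsub hx).1).smul_measure_nnreal).mono_measure hle⟩

variable {E : Type*} [NormedAddCommGroup E] [MeasurableSpace E] [BorelSpace E]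

lemma integrable_inv_norm_sub_of_integrableAtFilter {F : Measure E} [IsFiniteMeasure F] {x₀ : E}
    (h : IntegrableAtFilter (fun x => ‖x - x₀‖⁻¹) (𝓝 x₀) F) :
    Integrable (fun x => ‖x - x₀‖⁻¹) F := by
  obtain ⟨s, hs, hint⟩ := h
  obtain ⟨r, hr, hball⟩ := Metric.mem_nhds_iff.1 hs
  have hmeas : Measurable fun x : E => ‖x - x₀‖⁻¹ := by fun_prop
  rw [← integrableOn_univ, ← Set.union_compl_self (Metric.ball x₀ r)]
  refine (hint.mono_set hball).union (Integrable.of_bound hmeas.aestronglyMeasurable r⁻¹ ?_)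
  filter_upwards [ae_restrict_mem Metric.isOpen_ball.measurableSet.compl] with x hx
  rw [norm_inv, norm_norm]
  exact inv_anti₀ hr (by simpa [dist_eq_norm] using hx)

variable [NormedSpace ℝ E] [FiniteDimensional ℝ E]

lemma locallyIntegrable_inv_norm (hE : 1 < Module.finrank ℝ E) {m : Measure E}
    [m.IsAddHaarMeasure] : LocallyIntegrable (fun x => ‖x‖⁻¹) m :=
  locallyIntegrable_of_norm_le_rpow (α := 1) (C := 1) hE.le (mod_cast hE)
    (.of_forall fun x => by simp [Real.rpow_neg_one]) (by fun_prop)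

lemma integrableAtFilter_inv_norm_sub (hE : 1 < Module.finrank ℝ E) {m : Measure E}
    [m.IsAddHaarMeasure] (x₀ : E) :
    IntegrableAtFilter (fun x => ‖x - x₀‖⁻¹) (𝓝 x₀) m := by
  have h := locallyIntegrable_inv_norm hE (m := m)
  rw [← (measurePreserving_sub_right m x₀).map_eq] at h
  exact (locallyIntegrable_map_homeomorph (Homeomorph.subRight x₀)).1 h x₀

lemma HasBoundedDensityAt.integrable_inv_norm_sub {p : ℕ} (hp : 1 < p)
    {F : Measure (EuclideanSpace ℝ (Fin p))} [IsFiniteMeasure F] {μ : EuclideanSpace ℝ (Fin p)}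
    (h : HasBoundedDensityAt F μ) : Integrable (fun x => ‖x - μ‖⁻¹) F := by
  obtain ⟨f, -, rfl, C, hC⟩ := h
  exact integrable_inv_norm_sub_of_integrableAtFilter
    (integrableAtFilter_withDensity (integrableAtFilter_inv_norm_sub (by simpa using hp) μ) hC)

end InverseMoment

section WithDensity

variable {α : Type*} [MeasurableSpace α] {m : Measure α}

lemma map_withDensity_comp {β : Type*} [MeasurableSpace β] {f : α → β} (hf : Measurable f)
    {h : β → ℝ≥0∞} (hh : Measurable h) :
    (m.withDensity (h ∘ f)).map f = (m.map f).withDensity h := by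
  ext s hs
  rw [Measure.map_apply hf hs, withDensity_apply _ (hf hs), withDensity_apply _ hs,
    setLIntegral_map hs hh hf, Function.comp_def]

lemma measurePreserving_withDensity {f : α → α} (hf : MeasurePreserving f m m) {h : α → ℝ≥0∞}
    (hh : Measurable h) (hfh : h ∘ f = h) :
    MeasurePreserving f (m.withDensity h) (m.withDensity h) :=
  ⟨hf.measurable, by
    simpa only [hfh, hf.map_eq] using map_withDensity_comp (m := m) hf.measurable hh⟩

end WithDensity

section Moebius

variable {ζ w : ℂ}

lemma one_add_conj_mul_ne_zero (hζ : ‖ζ‖ < 1) (hw : ‖w‖ ≤ 1) : 1 + conj ζ * w ≠ 0 := by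
  intro h
  have hnorm : ‖conj ζ * w‖ = 1 := by
    rw [eq_neg_of_add_eq_zero_right h, norm_neg, norm_one]
  rw [norm_mul, RCLike.norm_conj] at hnorm
  exact (mul_lt_one_of_nonneg_of_lt_one_left (norm_nonneg ζ) hζ hw).ne hnorm

lemma signSq_add_mul_conj (hζ : ‖ζ‖ < 1) (hw : w ≠ 0) :
    signSq (w + ζ * conj w) = (signSq w + ζ) / (1 + conj ζ * signSq w) := by
  have hcw : conj w ≠ 0 := (map_ne_zero _).2 hw
  have hden : conj (w + ζ * conj w) = conj w * (1 + conj ζ * signSq w) := by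
    rw [signSq_of_ne_zero hw]
    simp only [map_add, map_mul, Complex.conj_conj]
    field_simp
  have hnum : w + ζ * conj w = conj w * (signSq w + ζ) := by
    rw [signSq_of_ne_zero hw]
    field_simp
  have hne : conj (w + ζ * conj w) ≠ 0 :=
    hden ▸ mul_ne_zero hcw (one_add_conj_mul_ne_zero hζ (norm_signSq w).le)
  rw [signSq_of_ne_zero ((map_ne_zero _).1 hne), hden, hnum, mul_div_mul_left _ _ hcw]

lemma circleAverage_moebius_pow (hζ : ‖ζ‖ < 1) (hw : ‖w‖ ≤ 1) (k : ℕ) :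
    Real.circleAverage (fun y => ((y ^ 2 * w + ζ) / (1 + conj ζ * (y ^ 2 * w))) ^ k) 0 1
      = ζ ^ k := by
  have hdiff : DiffContOnCl ℂ
      (fun y => ((y ^ 2 * w + ζ) / (1 + conj ζ * (y ^ 2 * w))) ^ k) (Metric.ball 0 |1|) := by
    refine DifferentiableOn.diffContOnCl fun y hy => ?_
    have hy : ‖y‖ ≤ 1 := by simpa using Metric.closure_ball_subset_closedBall hy
    have hyw : ‖y ^ 2 * w‖ ≤ 1 := by
      rw [norm_mul, norm_pow]
      exact mul_le_one₀ (pow_le_one₀ (norm_nonneg y) hy) (norm_nonneg w) hw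
    have := one_add_conj_mul_ne_zero hζ hyw
    exact DifferentiableAt.differentiableWithinAt (by fun_prop (disch := assumption))
  simpa using hdiff.circleAverage

lemma circleAverage_signSq_add_mul_conj_pow (hζ : ‖ζ‖ < 1) (hw : w ≠ 0) (k : ℕ) :
    Real.circleAverage (fun y => signSq (y * w + ζ * conj (y * w)) ^ k) 0 1 = ζ ^ k := by
  rw [← circleAverage_moebius_pow hζ (norm_signSq w).le k]
  refine Real.circleAverage_congr_sphere fun y hy => ?_
  have hy : ‖y‖ = 1 := by simpa using hy
  have hy0 : y ≠ 0 := norm_ne_zero_iff.1 (hy ▸ one_ne_zero)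
  have hsign : signSq (y * w) = y ^ 2 * signSq w := by
    rw [signSq_mul hy0 hw, signSq_eq_normalize_sq hy0,
      NormedSpace.normalize_eq_self_of_norm_eq_one hy]
  simp only [signSq_add_mul_conj hζ (mul_ne_zero hy0 hw), hsign]

end Moebius

section RotationInvariant

lemma integral_circleAverage_mul {m : Measure ℂ} [SFinite m] {E : Type*} [NormedAddCommGroup E]
    [NormedSpace ℝ E] [CompleteSpace E]
    (hrot : ∀ c : Circle, MeasurePreserving (rotation c) m m) {f : ℂ → E} (hf : Integrable f m) :
    ∫ u, Real.circleAverage (fun y => f (y * u)) 0 1 ∂m = ∫ u, f u ∂m := by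
  let ℓ : Measure ℝ := volume.restrict (Set.uIoc 0 (2 * Real.pi))
  have : IsFiniteMeasure ℓ := inferInstanceAs (IsFiniteMeasure (volume.restrict (Set.Ioc _ _)))
  have hskew : MeasurePreserving (fun p : ℝ × ℂ => (p.1, (Circle.exp p.1 : ℂ) * p.2))
      (ℓ.prod m) (ℓ.prod m) :=
    (MeasurePreserving.id ℓ).skew_product (g := fun θ u => (Circle.exp θ : ℂ) * u)
      (Continuous.measurable (by fun_prop)) (.of_forall fun θ => (hrot (Circle.exp θ)).map_eq)
  have hint : Integrable (fun p : ℝ × ℂ => f (Circle.exp p.1 * p.2)) (ℓ.prod m) :=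
    hskew.integrable_comp_of_integrable (hf.comp_snd ℓ)
  have hconst (θ : ℝ) : ∫ u, f (Circle.exp θ * u) ∂m = ∫ u, f u ∂m :=
    (hrot (Circle.exp θ)).integral_comp
      (rotation (Circle.exp θ)).toHomeomorph.measurableEmbedding f
  have hcircleMap (θ : ℝ) : circleMap 0 1 θ = Circle.exp θ := by
    rw [circleMap_zero, Circle.coe_exp, Complex.ofReal_one, one_mul]
  simp only [Real.circleAverage_def, hcircleMap, integral_smul]
  rw [← intervalIntegral_integral_swap (f := fun θ u => f (Circle.exp θ * u)) hint]
  simp_rw [hconst, intervalIntegral.integral_const, sub_zero]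
  exact inv_smul_smul₀ Real.two_pi_pos.ne' _

lemma integral_signSq_add_mul_conj_pow {m : Measure ℂ} [IsProbabilityMeasure m]
    (hrot : ∀ c : Circle, MeasurePreserving (rotation c) m m) (h0 : ∀ᵐ u ∂m, u ≠ 0) {ζ : ℂ}
    (hζ : ‖ζ‖ < 1) (k : ℕ) : ∫ u, signSq (u + ζ * conj u) ^ k ∂m = ζ ^ k := by
  have hmeas : Measurable fun u => signSq (u + ζ * conj u) ^ k :=
    (measurable_signSq.comp (by fun_prop)).pow_const k
  have hint : Integrable (fun u => signSq (u + ζ * conj u) ^ k) m :=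
    .of_bound hmeas.aestronglyMeasurable 1 (.of_forall fun u => by simp [norm_signSq])
  rw [← integral_circleAverage_mul hrot hint, integral_congr_ae (g := fun _ => ζ ^ k) (h0.mono
    fun u hu => circleAverage_signSq_add_mul_conj_pow hζ hu k), integral_const, probReal_univ,
    one_smul]

end RotationInvariant

/-- The real-linear map `w ↦ w - ζ * conj w`. For `‖ζ‖ < 1` it maps an ellipse centred at the
origin onto a circle, and every such ellipse arises from exactly one `ζ`. -/
noncomputable def shear (ζ : ℂ) : ℂ →L[ℝ] ℂ := .id ℝ ℂ - ζ • (Complex.conjCLE : ℂ →L[ℝ] ℂ)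

lemma shear_apply (ζ w : ℂ) : shear ζ w = w - ζ * conj w := by simp [shear]

lemma shear_add_mul_conj_shear (ζ w : ℂ) :
    shear ζ w + ζ * conj (shear ζ w) = ((1 - ‖ζ‖ ^ 2 : ℝ) : ℂ) * w := by
  rw [shear_apply, ← Complex.normSq_eq_norm_sq]
  push_cast
  rw [← Complex.mul_conj]
  simp only [map_sub, map_mul, Complex.conj_conj]
  ring

/-- The elliptical measure on `ℂ` centred at the origin, with density `w ↦ D ‖w - ζ * conj w‖`.
Its shape is encoded by `ζ`, instead of a matrix, because `ζ` is then the mean squared sign. -/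
noncomputable def ellipticalMeasure (D : ℝ → ℝ≥0∞) (ζ : ℂ) : Measure ℂ :=
  volume.withDensity ((fun u => D ‖u‖) ∘ shear ζ)

section EllipticalMeasure

variable {D : ℝ → ℝ≥0∞} {ζ : ℂ}

lemma isNegInvariant_ellipticalMeasure (hD : Measurable D) :
    (ellipticalMeasure D ζ).IsNegInvariant :=
  ⟨(measurePreserving_withDensity (Measure.measurePreserving_neg volume) (by fun_prop)
    (by ext w; simp)).map_eq⟩

lemma ellipticalMeasure_ae_ne_zero : ∀ᵐ z ∂ellipticalMeasure D ζ, z ≠ 0 :=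
  (withDensity_absolutelyContinuous _ _).ae_le (volume.ae_ne 0)

lemma signSq_shear_add_mul_conj_shear (hζ : ‖ζ‖ < 1) (w : ℂ) :
    signSq (shear ζ w + ζ * conj (shear ζ w)) = signSq w := by
  have hscale : ((1 - ‖ζ‖ ^ 2 : ℝ) : ℂ) ≠ 0 :=
    Complex.ofReal_ne_zero.2 (sub_pos.2 (pow_lt_one₀ (norm_nonneg ζ) hζ two_ne_zero)).ne'
  rcases eq_or_ne w 0 with rfl | hw
  · simp
  · rw [shear_add_mul_conj_shear, signSq_mul hscale hw, signSq_of_ne_zero hscale,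
      Complex.conj_ofReal, div_self hscale, one_mul]

lemma shear_injective (hζ : ‖ζ‖ < 1) : Function.Injective (shear ζ) := by
  refine (injective_iff_map_eq_zero _).2 fun w hw => ?_
  have hscale : 1 - ‖ζ‖ ^ 2 ≠ 0 :=
    (sub_pos.2 (pow_lt_one₀ (norm_nonneg ζ) hζ two_ne_zero)).ne'
  have h := shear_add_mul_conj_shear ζ w
  rw [hw, map_zero, mul_zero, add_zero] at h
  exact (mul_eq_zero.1 h.symm).resolve_left (Complex.ofReal_ne_zero.2 hscale)

lemma exists_map_shear_ellipticalMeasure_eq (hD : Measurable D) (hζ : ‖ζ‖ < 1) :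
    ∃ c : ℝ≥0∞, (ellipticalMeasure D ζ).map (shear ζ)
      = (c • volume).withDensity fun u => D ‖u‖ := by
  have hdet : LinearMap.det (shear ζ : ℂ →ₗ[ℝ] ℂ) ≠ 0 :=
    (LinearEquiv.ofInjectiveEndo (shear ζ : ℂ →ₗ[ℝ] ℂ) (shear_injective hζ)).isUnit_det'.ne_zero
  refine ⟨.ofReal |(LinearMap.det (shear ζ : ℂ →ₗ[ℝ] ℂ))⁻¹|, ?_⟩
  rw [ellipticalMeasure, map_withDensity_comp (shear ζ).measurable (by fun_prop)]
  exact congrArg (Measure.withDensity · _)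
    (Measure.map_linearMap_addHaar_eq_smul_addHaar volume hdet)

lemma integral_signSq_pow_ellipticalMeasure (hD : Measurable D)
    [IsProbabilityMeasure (ellipticalMeasure D ζ)] (hζ : ‖ζ‖ < 1) (k : ℕ) :
    ∫ z, signSq z ^ k ∂ellipticalMeasure D ζ = ζ ^ k := by
  obtain ⟨c, hmap⟩ := exists_map_shear_ellipticalMeasure_eq hD hζ
  have hprob := Measure.isProbabilityMeasure_map (μ := ellipticalMeasure D ζ)
    (shear ζ).measurable.aemeasurable
  have hrot (a : Circle) : MeasurePreserving (rotation a)
      ((ellipticalMeasure D ζ).map (shear ζ)) ((ellipticalMeasure D ζ).map (shear ζ)) := by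
    rw [hmap]
    exact measurePreserving_withDensity ((rotation a).measurePreserving.smul_measure c)
      (by fun_prop) (by ext u; simp only [Function.comp_apply, LinearIsometryEquiv.norm_map])
  have h0 : ∀ᵐ u ∂(ellipticalMeasure D ζ).map (shear ζ), u ≠ 0 := by
    rw [hmap]
    exact (withDensity_absolutelyContinuous _ _).ae_le
      (Measure.ae_smul_measure (volume.ae_ne 0) c)
  have hmeas : Measurable fun u => signSq (u + ζ * conj u) ^ k :=
    (measurable_signSq.comp (by fun_prop)).pow_const k
  rw [← integral_signSq_add_mul_conj_pow hrot h0 hζ k,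
    integral_map (shear ζ).measurable.aemeasurable hmeas.aestronglyMeasurable]
  simp only [signSq_shear_add_mul_conj_shear hζ]

end EllipticalMeasure

/-- The identification of the Euclidean plane with `ℂ`, through which the spatial signs are
treated as unimodular complex numbers. -/
noncomputable def toComplex : EuclideanSpace ℝ (Fin 2) ≃ₗᵢ[ℝ] ℂ :=
  Complex.orthonormalBasisOneI.repr.symm

@[simp]
lemma toComplex_re (x : EuclideanSpace ℝ (Fin 2)) : (toComplex x).re = x 0 := by
  simp [toComplex]

@[simp]
lemma toComplex_im (x : EuclideanSpace ℝ (Fin 2)) : (toComplex x).im = x 1 := by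
  simp [toComplex]

lemma toComplex_spatialSign (x : EuclideanSpace ℝ (Fin 2)) :
    toComplex (spatialSign x) = NormedSpace.normalize (toComplex x) := by
  rw [spatialSign, map_smul, NormedSpace.normalize, LinearIsometryEquiv.norm_map]

lemma spatialSign_zero_mul_zero (x : EuclideanSpace ℝ (Fin 2)) :
    spatialSign x 0 * spatialSign x 0 = (1 + (signSq (toComplex x)).re) / 2 := by
  rcases eq_or_ne x 0 with rfl | hx
  · simp [spatialSign, signSq]
  have hx : toComplex x ≠ 0 := by simpa using hx
  have hunit := Complex.sq_norm (NormedSpace.normalize (toComplex x))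
  rw [NormedSpace.norm_normalize hx, Complex.normSq_apply] at hunit
  rw [← toComplex_re, toComplex_spatialSign, signSq_eq_normalize_sq hx, sq, Complex.mul_re]
  linear_combination -hunit / 2

lemma spatialSign_zero_mul_one (x : EuclideanSpace ℝ (Fin 2)) :
    spatialSign x 0 * spatialSign x 1 = (signSq (toComplex x)).im / 2 := by
  rcases eq_or_ne x 0 with rfl | hx
  · simp [spatialSign, signSq]
  rw [← toComplex_re, ← toComplex_im, toComplex_spatialSign,
    signSq_eq_normalize_sq (by simpa using hx), sq, Complex.mul_im]
  ring

/-- The spatial sign correlation of the spatial sign covariance matrix whose mean squared sign,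
under `toComplex`, is `z`. -/
noncomputable def correlationOfSignMean (z : ℂ) : ℝ :=
  spatialSignCorrelation !![(1 + z.re) / 2, z.im / 2; z.im / 2, (1 - z.re) / 2]

lemma measurable_correlationOfSignMean : Measurable correlationOfSignMean := by
  unfold correlationOfSignMean spatialSignCorrelation
  simp only [Matrix.of_apply, Matrix.cons_val', Matrix.cons_val_zero, Matrix.cons_val_one]
  fun_prop

lemma spatialSignCorrelation_sscm (n : ℕ) (x : ℕ → EuclideanSpace ℝ (Fin 2))
    (t : EuclideanSpace ℝ (Fin 2)) :
    spatialSignCorrelation (sscm (fun i : Fin n => x i) t)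
      = correlationOfSignMean (sampleMean (fun i => signSq (toComplex (x i - t))) n) := by
  rcases eq_or_ne n 0 with rfl | hn
  · simp [correlationOfSignMean, spatialSignCorrelation, sscm, sampleMean]
  set S := sscm (fun i : Fin n => x i) t
  set z := sampleMean (fun i => signSq (toComplex (x i - t))) n
  have hn' : (n : ℝ) ≠ 0 := Nat.cast_ne_zero.2 hn
  have h00 : S 0 0 = (1 + z.re) / 2 := by
    simp only [S, z, sscm, sampleMean, Matrix.smul_apply, Matrix.sum_apply,
      Matrix.vecMulVec_apply, spatialSign_zero_mul_zero, Complex.smul_re, Complex.re_sum,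
      smul_eq_mul]
    rw [Fin.sum_univ_eq_sum_range (fun i => (1 + (signSq (toComplex (x i - t))).re) / 2),
      ← Finset.sum_div, Finset.sum_add_distrib, Finset.sum_const, Finset.card_range,
      nsmul_eq_mul, mul_one]
    field_simp
  have h01 : S 0 1 = z.im / 2 := by
    simp only [S, z, sscm, sampleMean, Matrix.smul_apply, Matrix.sum_apply,
      Matrix.vecMulVec_apply, spatialSign_zero_mul_one, Complex.smul_im, Complex.im_sum,
      smul_eq_mul]
    rw [Fin.sum_univ_eq_sum_range (fun i => (signSq (toComplex (x i - t))).im / 2),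
      ← Finset.sum_div, mul_div_assoc]
  simp [correlationOfSignMean, spatialSignCorrelation, h00, h01]

section CorrelationOfSignMean

variable {z : ℂ}

lemma norm_one_sub_sq_sq (z : ℂ) : ‖1 - z ^ 2‖ ^ 2 = (1 - ‖z‖ ^ 2) ^ 2 + 4 * z.im ^ 2 := by
  rw [Complex.sq_norm, Complex.sq_norm, Complex.normSq_apply, Complex.normSq_apply]
  simp only [sq, Complex.sub_re, Complex.one_re, Complex.mul_re, Complex.sub_im, Complex.one_im,
    Complex.mul_im]
  ring

-- Here `b = (‖z‖ - re z) / 2` satisfies `s₁₂² + b² = ‖z‖ b`, so that `b` cancels.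
lemma correlationOfSignMean_eq_div_norm (hz : ‖z‖ < 1) :
    correlationOfSignMean z = 2 * z.im / ‖1 - z ^ 2‖ := by
  have hdet : 0 < 1 - ‖z‖ ^ 2 := sub_pos.2 (pow_lt_one₀ (norm_nonneg z) hz two_ne_zero)
  have hnorm : ‖z‖ ^ 2 = z.re ^ 2 + z.im ^ 2 := by
    rw [Complex.sq_norm, Complex.normSq_apply, sq, sq]
  have hd : 1 / 2 + √(((1 + z.re) / 2 - 1 / 2) ^ 2 + (z.im / 2) ^ 2) = (1 + ‖z‖) / 2 := by
    rw [show ((1 + z.re) / 2 - 1 / 2) ^ 2 + (z.im / 2) ^ 2 = (‖z‖ / 2) ^ 2 by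
      linear_combination -hnorm / 4, Real.sqrt_sq (by positivity)]
    ring
  have hc : (2 * ((1 + ‖z‖) / 2) - 1) / ((1 + ‖z‖) / 2 * (1 - (1 + ‖z‖) / 2))
      = 4 * ‖z‖ / (1 - ‖z‖ ^ 2) := by
    rw [show (1 + ‖z‖) / 2 * (1 - (1 + ‖z‖) / 2) = (1 - ‖z‖ ^ 2) / 4 by ring]
    field_simp
    ring
  have hb : (1 + ‖z‖) / 2 - (1 + z.re) / 2 = (‖z‖ - z.re) / 2 := by ring
  simp only [correlationOfSignMean, spatialSignCorrelation, Matrix.of_apply, Matrix.cons_val',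
    Matrix.cons_val_zero, Matrix.cons_val_one, hd, hc, hb]
  rcases eq_or_ne z.im 0 with him | him
  · simp [him]
  have hz0 : 0 < ‖z‖ := norm_pos_iff.2 fun h => him (by simp [h])
  have hbpos : 0 < ‖z‖ - z.re := sub_pos.2 ((le_abs_self _).trans_lt (Complex.abs_re_lt_norm.2 him))
  have hden : ((z.im / 2) ^ 2 + ((‖z‖ - z.re) / 2) ^ 2) ^ 2
        + (z.im / 2 * (4 * ‖z‖ / (1 - ‖z‖ ^ 2)) * ((‖z‖ - z.re) / 2)) ^ 2
      = (‖z‖ * ((‖z‖ - z.re) / 2) / (1 - ‖z‖ ^ 2) * ‖1 - z ^ 2‖) ^ 2 := by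
    rw [show (z.im / 2) ^ 2 + ((‖z‖ - z.re) / 2) ^ 2 = ‖z‖ * ((‖z‖ - z.re) / 2) by
      linear_combination -hnorm / 4, mul_pow _ ‖1 - z ^ 2‖, norm_one_sub_sq_sq]
    field_simp
    ring
  rw [hden, Real.sqrt_sq (by positivity)]
  field_simp
  norm_num

lemma re_one_add_div_one_sub (z : ℂ) :
    ((1 + z) / (1 - z)).re = (1 - ‖z‖ ^ 2) / Complex.normSq (1 - z) := by
  rw [Complex.div_re, Complex.sq_norm, Complex.normSq_apply z]
  simp only [Complex.add_re, Complex.add_im, Complex.sub_re, Complex.sub_im, Complex.one_re,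
    Complex.one_im]
  ring

lemma im_one_add_div_one_sub (z : ℂ) :
    ((1 + z) / (1 - z)).im = 2 * z.im / Complex.normSq (1 - z) := by
  rw [Complex.div_im]
  simp only [Complex.add_re, Complex.add_im, Complex.sub_re, Complex.sub_im, Complex.one_re,
    Complex.one_im]
  ring

lemma norm_one_add_div_one_sub (z : ℂ) :
    ‖(1 + z) / (1 - z)‖ = ‖1 - z ^ 2‖ / Complex.normSq (1 - z) := by
  rw [Complex.normSq_eq_norm_sq, show 1 - z ^ 2 = (1 + z) * (1 - z) by ring, norm_mul, norm_div]
  rcases eq_or_ne ‖1 - z‖ 0 with h | h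
  · simp [h]
  · field_simp

lemma normSq_one_sub_pos (hz : ‖z‖ < 1) : 0 < Complex.normSq (1 - z) :=
  Complex.normSq_pos.2 (sub_ne_zero.2 fun h => by simp [← h] at hz)

lemma sin_arg_one_add_div_one_sub (hz : ‖z‖ < 1) :
    Real.sin ((1 + z) / (1 - z)).arg = 2 * z.im / ‖1 - z ^ 2‖ := by
  rw [Complex.sin_arg, im_one_add_div_one_sub, norm_one_add_div_one_sub,
    div_div_div_cancel_right₀ (normSq_one_sub_pos hz).ne']

lemma one_add_div_one_sub_mem_slitPlane (hz : ‖z‖ < 1) : (1 + z) / (1 - z) ∈ Complex.slitPlane := by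
  refine .inl ?_
  rw [re_one_add_div_one_sub]
  exact div_pos (sub_pos.2 (pow_lt_one₀ (norm_nonneg z) hz two_ne_zero)) (normSq_one_sub_pos hz)

lemma cos_arg_one_add_div_one_sub (hz : ‖z‖ < 1) :
    Real.cos ((1 + z) / (1 - z)).arg = (1 - ‖z‖ ^ 2) / ‖1 - z ^ 2‖ := by
  rw [Complex.cos_arg (Complex.slitPlane_ne_zero (one_add_div_one_sub_mem_slitPlane hz)),
    re_one_add_div_one_sub, norm_one_add_div_one_sub,
    div_div_div_cancel_right₀ (normSq_one_sub_pos hz).ne']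

lemma hasDerivAt_log_one_add_div_one_sub (hz : ‖z‖ < 1) :
    HasDerivAt (fun w => Complex.log ((1 + w) / (1 - w))) (2 / (1 - z ^ 2)) z := by
  have hsub : 1 - z ≠ 0 := Complex.normSq_pos.1 (normSq_one_sub_pos hz)
  have hmem := one_add_div_one_sub_mem_slitPlane hz
  have hadd : 1 + z ≠ 0 := left_ne_zero_of_mul (div_eq_mul_inv (1 + z) _ ▸
    Complex.slitPlane_ne_zero hmem)
  have h := (((hasDerivAt_id z).const_add 1).div ((hasDerivAt_id z).const_sub 1) hsub).clog hmem
  refine h.congr_deriv ?_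
  rw [show 1 - z ^ 2 = (1 + z) * (1 - z) by ring]
  simp only [id, Pi.div_apply]
  field_simp
  ring

lemma hasGradientAt_im {f : ℂ → ℂ} {f' : ℂ} (hf : HasDerivAt f f' z) :
    HasGradientAt (fun w => (f w).im) (Complex.I * conj f') z := by
  refine (Complex.imCLM.hasFDerivAt.comp z
    (hf.hasFDerivAt.restrictScalars ℝ)).congr_fderiv ?_
  ext; simp [add_comm]

lemma hasGradientAt_correlationOfSignMean (hz : ‖z‖ < 1) :
    HasGradientAt correlationOfSignMean
      (((1 - ‖z‖ ^ 2) / ‖1 - z ^ 2‖) • (Complex.I * conj (2 / (1 - z ^ 2)))) z := by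
  have hsin : correlationOfSignMean =ᶠ[𝓝 z] fun w =>
      Real.sin (Complex.log ((1 + w) / (1 - w))).im := by
    filter_upwards [continuous_norm.continuousAt.eventually_lt_const hz] with w hw
    rw [correlationOfSignMean_eq_div_norm hw, Complex.log_im, sin_arg_one_add_div_one_sub hw]
  have h := (hasGradientAt_im (hasDerivAt_log_one_add_div_one_sub hz)).hasFDerivAt.sin
  rw [Complex.log_im, cos_arg_one_add_div_one_sub hz] at h
  refine (h.congr_of_eventuallyEq hsin).congr_fderiv ?_
  rw [map_smul]

lemma norm_gradient_correlationOfSignMean (hz : ‖z‖ < 1) :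
    ‖gradient correlationOfSignMean z‖ = 2 * (1 - ‖z‖ ^ 2) / ‖1 - z ^ 2‖ ^ 2 := by
  have hpos : 0 ≤ 1 - ‖z‖ ^ 2 := sub_nonneg.2 (pow_le_one₀ (norm_nonneg z) hz.le)
  rw [(hasGradientAt_correlationOfSignMean hz).gradient, norm_smul, norm_mul, Complex.norm_I,
    one_mul, RCLike.norm_conj, norm_div, norm_div, norm_norm, Real.norm_of_nonneg hpos,
    Complex.norm_two]
  ring

end CorrelationOfSignMean

/-- The mean squared sign of the centred elliptical distributions with shape matrix `V`, under
`toComplex`. -/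
noncomputable def signMean (V : Matrix (Fin 2) (Fin 2) ℝ) : ℂ :=
  ⟨(V 0 0 - V 1 1) / (V.trace + 2 * √V.det), 2 * V 0 1 / (V.trace + 2 * √V.det)⟩

section Shape

variable {V : Matrix (Fin 2) (Fin 2) ℝ}

lemma dotProduct_inv_mulVec_fin_two (hV : V.IsHermitian) (x : Fin 2 → ℝ) :
    x ⬝ᵥ (V⁻¹ *ᵥ x)
      = (V 1 1 * x 0 ^ 2 - 2 * V 0 1 * x 0 * x 1 + V 0 0 * x 1 ^ 2) / V.det := by
  rw [Matrix.inv_def, Matrix.adjugate_fin_two, Ring.inverse_eq_inv', ← hV.apply 1 0, star_trivial]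
  simp only [Matrix.mulVec, dotProduct, Fin.sum_univ_two, Matrix.smul_apply, Matrix.of_apply,
    Matrix.cons_val', Matrix.cons_val_zero, Matrix.cons_val_one, Matrix.cons_val_fin_one,
    smul_eq_mul]
  ring

lemma sq_sqrt_det (hV : V.PosDef) : √V.det ^ 2 = V 0 0 * V 1 1 - V 0 1 ^ 2 := by
  rw [Real.sq_sqrt hV.det_pos.le, Matrix.det_fin_two, ← hV.isHermitian.apply 1 0,
    star_trivial, sq]

lemma sqrt_det_pos (hV : V.PosDef) : 0 < √V.det := Real.sqrt_pos.2 hV.det_pos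

lemma sqrt_diag_mul_diag_pos (hV : V.PosDef) : 0 < √(V 0 0 * V 1 1) :=
  Real.sqrt_pos.2 (mul_pos hV.diag_pos hV.diag_pos)

lemma trace_add_two_mul_sqrt_det_pos (hV : V.PosDef) : 0 < V.trace + 2 * √V.det :=
  add_pos hV.trace_pos (mul_pos two_pos (sqrt_det_pos hV))

lemma one_sub_norm_signMean_sq (hV : V.PosDef) :
    1 - ‖signMean V‖ ^ 2 = 4 * √V.det / (V.trace + 2 * √V.det) := by
  have hN := trace_add_two_mul_sqrt_det_pos hV
  rw [Complex.sq_norm, Complex.normSq_apply, signMean, ← sub_eq_zero]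
  field_simp
  rw [Matrix.trace_fin_two]
  linear_combination -4 * sq_sqrt_det hV

lemma norm_signMean_lt_one (hV : V.PosDef) : ‖signMean V‖ < 1 := by
  have hpos : 0 < 1 - ‖signMean V‖ ^ 2 := by
    rw [one_sub_norm_signMean_sq hV]
    exact div_pos (mul_pos four_pos (sqrt_det_pos hV)) (trace_add_two_mul_sqrt_det_pos hV)
  exact lt_of_pow_lt_pow_left₀ 2 zero_le_one (by rwa [one_pow, ← sub_pos])

lemma norm_one_sub_signMean_sq (hV : V.PosDef) :
    ‖1 - signMean V ^ 2‖ = 4 * √(V 0 0 * V 1 1) / (V.trace + 2 * √V.det) := by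
  have hN := trace_add_two_mul_sqrt_det_pos hV
  rw [← sq_eq_sq₀ (norm_nonneg _) (by positivity), norm_one_sub_sq_sq,
    one_sub_norm_signMean_sq hV, div_pow _ _ 2, mul_pow _ _ 2, div_pow, mul_pow,
    Real.sq_sqrt (mul_pos hV.diag_pos hV.diag_pos).le, sq_sqrt_det hV, signMean]
  field_simp
  ring

lemma correlationOfSignMean_signMean (hV : V.PosDef) :
    correlationOfSignMean (signMean V) = generalizedCorrelation V := by
  have hN := trace_add_two_mul_sqrt_det_pos hV
  have hσ := sqrt_diag_mul_diag_pos hV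
  rw [correlationOfSignMean_eq_div_norm (norm_signMean_lt_one hV), norm_one_sub_signMean_sq hV,
    generalizedCorrelation, signMean]
  field_simp
  ring

lemma one_sub_generalizedCorrelation_sq (hV : V.PosDef) :
    1 - generalizedCorrelation V ^ 2 = (√V.det / √(V 0 0 * V 1 1)) ^ 2 := by
  have hσ := mul_pos (hV.diag_pos (i := 0)) (hV.diag_pos (i := 1))
  rw [generalizedCorrelation, div_pow, div_pow, sq_sqrt_det hV, Real.sq_sqrt hσ.le, sub_div,
    div_self hσ.ne']

lemma sqrt_div_add_inv {x y : ℝ} (hx : 0 < x) (hy : 0 < y) :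
    √(x / y) + (√(x / y))⁻¹ = (x + y) / √(x * y) := by
  rw [Real.sqrt_div hx.le, Real.sqrt_mul hx.le, inv_div,
    div_add_div _ _ (Real.sqrt_pos.2 hy).ne' (Real.sqrt_pos.2 hx).ne', Real.mul_self_sqrt hx.le,
    Real.mul_self_sqrt hy.le, mul_comm √y]

lemma asymptoticVariance_generalizedCorrelation (hV : V.PosDef) :
    asymptoticVariance (generalizedCorrelation V) √(V 0 0 / V 1 1)
      = ‖gradient correlationOfSignMean (signMean V)‖ ^ 2 * (1 - ‖signMean V‖ ^ 2) / 2 := by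
  have hδ := sqrt_det_pos hV
  have hσ := sqrt_diag_mul_diag_pos hV
  have hpow : ((√V.det / √(V 0 0 * V 1 1)) ^ 2) ^ (3 / 2 : ℝ)
      = (√V.det / √(V 0 0 * V 1 1)) ^ 3 := by
    rw [← Real.rpow_natCast, ← Real.rpow_mul (by positivity), ← Real.rpow_natCast]
    norm_num
  rw [asymptoticVariance, one_sub_generalizedCorrelation_sq hV, hpow,
    sqrt_div_add_inv hV.diag_pos hV.diag_pos,
    norm_gradient_correlationOfSignMean (norm_signMean_lt_one hV), one_sub_norm_signMean_sq hV,
    norm_one_sub_signMean_sq hV, ← Matrix.trace_fin_two]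
  field_simp
  ring

lemma dotProduct_inv_mulVec_eq_norm_shear_sq (hV : V.PosDef) (x : EuclideanSpace ℝ (Fin 2)) :
    x.ofLp ⬝ᵥ (V⁻¹ *ᵥ x.ofLp) = ‖shear (signMean V) (toComplex x)‖ ^ 2
      * ((V.trace + 2 * √V.det) / (4 * V.det)) := by
  have hN := trace_add_two_mul_sqrt_det_pos hV
  have hdet := hV.det_pos
  rw [dotProduct_inv_mulVec_fin_two hV.isHermitian, Complex.sq_norm, Complex.normSq_apply,
    shear_apply]
  simp only [Complex.sub_re, Complex.sub_im, Complex.mul_re, Complex.mul_im, Complex.conj_re,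
    Complex.conj_im, toComplex_re, toComplex_im, signMean]
  field_simp
  rw [Matrix.trace_fin_two]
  linear_combination (-4 * (x.ofLp 0 ^ 2 + x.ofLp 1 ^ 2)) * sq_sqrt_det hV

end Shape

lemma IsElliptical.exists_hasLaw_toComplex_sub {μ : EuclideanSpace ℝ (Fin 2)}
    {V : Matrix (Fin 2) (Fin 2) ℝ} {F : Measure (EuclideanSpace ℝ (Fin 2))}
    (hF : IsElliptical μ V F) :
    ∃ D, Measurable D ∧
      HasLaw (fun x => toComplex (x - μ)) (ellipticalMeasure D (signMean V)) F := by
  obtain ⟨-, hV, g, hg, -, rfl⟩ := hF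
  let D : ℝ → ℝ≥0∞ := fun r => ENNReal.ofReal ((√V.det)⁻¹ *
    g (r ^ 2 * ((V.trace + 2 * √V.det) / (4 * V.det))))
  have hD : Measurable D := ((hg.comp (by fun_prop)).const_mul _).ennreal_ofReal
  have hmap : MeasurePreserving fun x : EuclideanSpace ℝ (Fin 2) => toComplex (x - μ) :=
    toComplex.measurePreserving.comp (measurePreserving_sub_right volume μ)
  refine ⟨D, hD, hmap.measurable.aemeasurable, ?_⟩
  rw [ellipticalMeasure, ← hmap.map_eq, ← map_withDensity_comp hmap.measurable (by fun_prop)]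
  simp only [dotProduct_inv_mulVec_eq_norm_shear_sq hV]
  rfl

section EllipticalSample

variable {Ω : Type*} [MeasurableSpace Ω] {P : Measure Ω} {D : ℝ → ℝ≥0∞} {ζ : ℂ}
  [IsProbabilityMeasure (ellipticalMeasure D ζ)] {Z T : ℕ → Ω → ℂ}

lemma integral_signSq_ellipticalMeasure (hD : Measurable D) (hζ : ‖ζ‖ < 1) :
    ∫ z, signSq z ∂ellipticalMeasure D ζ = ζ := by
  simpa only [pow_one] using integral_signSq_pow_ellipticalMeasure hD hζ 1

lemma variance_inner_signSq_ellipticalMeasure (hD : Measurable D) (hζ : ‖ζ‖ < 1) (v : ℂ) :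
    Var[fun z => ⟪v, signSq z⟫; ellipticalMeasure D ζ] = ‖v‖ ^ 2 * (1 - ‖ζ‖ ^ 2) / 2 := by
  have hmean := integral_signSq_ellipticalMeasure hD hζ
  rw [variance_inner_of_norm_eq_one measurable_signSq norm_signSq
    (by rw [integral_signSq_pow_ellipticalMeasure hD hζ, hmean]), hmean]

lemma ae_tendsto_correlationOfSignMean_ellipticalMeasure (hD : Measurable D) (hζ : ‖ζ‖ < 1)
    (hlaw : ∀ i, HasLaw (Z i) (ellipticalMeasure D ζ) P) (hind : iIndepFun Z P)
    (hinv : Integrable (fun z => ‖z‖⁻¹) (ellipticalMeasure D ζ))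
    (hT : ∀ n, ∀ᵐ ω ∂P,
      ∑ i ∈ Finset.range n, ‖Z i ω - T n ω‖ ≤ ∑ i ∈ Finset.range n, ‖Z i ω‖) :
    ∀ᵐ ω ∂P, Tendsto
      (fun n => correlationOfSignMean (sampleMean (fun i => signSq (Z i ω - T n ω)) n)) atTop
      (𝓝 (correlationOfSignMean ζ)) := by
  have := isNegInvariant_ellipticalMeasure (ζ := ζ) hD
  have hmean := integral_signSq_ellipticalMeasure hD hζ
  filter_upwards [ae_tendsto_sampleMean_signSq_sub_median hlaw hind ellipticalMeasure_ae_ne_zero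
    hinv (hmean.symm ▸ hζ) hT] with ω hω
  rw [hmean] at hω
  exact (hasGradientAt_correlationOfSignMean hζ).differentiableAt.continuousAt.tendsto.comp hω

lemma tendstoInDistribution_correlationOfSignMean_ellipticalMeasure [IsProbabilityMeasure P]
    (hD : Measurable D) (hζ : ‖ζ‖ < 1) (hlaw : ∀ i, HasLaw (Z i) (ellipticalMeasure D ζ) P)
    (hind : iIndepFun Z P) (hinv : Integrable (fun z => ‖z‖⁻¹) (ellipticalMeasure D ζ))
    (hTm : ∀ n, AEMeasurable (T n) P)
    (hT : ∀ n, ∀ᵐ ω ∂P,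
      ∑ i ∈ Finset.range n, ‖Z i ω - T n ω‖ ≤ ∑ i ∈ Finset.range n, ‖Z i ω‖) :
    TendstoInDistribution (fun (n : ℕ) ω => √(n : ℝ) *
      (correlationOfSignMean (sampleMean (fun i => signSq (Z i ω - T n ω)) n)
        - correlationOfSignMean ζ)) atTop (id : ℝ → ℝ) (fun _ => P)
      (gaussianReal 0
        (‖gradient correlationOfSignMean ζ‖ ^ 2 * (1 - ‖ζ‖ ^ 2) / 2).toNNReal) := by
  have := isNegInvariant_ellipticalMeasure (ζ := ζ) hD
  have hmean := integral_signSq_ellipticalMeasure hD hζ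
  have hgrad := (hasGradientAt_correlationOfSignMean hζ).differentiableAt.hasGradientAt
  have hclt := tendstoInDistribution_sqrt_mul_sub_of_hasGradientAt hlaw hind
    ellipticalMeasure_ae_ne_zero hinv (hmean.symm ▸ hζ) hTm hT measurable_correlationOfSignMean
    (hmean.symm ▸ hgrad)
  simpa only [hmean, variance_inner_signSq_ellipticalMeasure hD hζ] using hclt

end EllipticalSample

end SpatialSign

open SpatialSign in
theorem proposition3_general
    {Ω : Type*} [MeasurableSpace Ω] (P : Measure Ω) [IsProbabilityMeasure P]
    (μ : EuclideanSpace ℝ (Fin 2)) (V : Matrix (Fin 2) (Fin 2) ℝ)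
    (F : Measure (EuclideanSpace ℝ (Fin 2))) (hF : IsElliptical μ V F)
    (hinv : Integrable (fun x => ‖x - μ‖⁻¹) F)
    (X : ℕ → Ω → EuclideanSpace ℝ (Fin 2)) (hXm : ∀ i, AEMeasurable (X i) P)
    (hXind : iIndepFun X P) (hXlaw : ∀ i, P.map (X i) = F)
    (T : ℕ → Ω → EuclideanSpace ℝ (Fin 2)) (hTm : ∀ n, AEMeasurable (T n) P)
    (hT : ∀ n, ∀ᵐ ω ∂P, ∑ i : Fin n, ‖X i ω - T n ω‖ ≤ ∑ i : Fin n, ‖X i ω - μ‖) :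
    (∀ᵐ ω ∂P, Tendsto (fun n => spatialSignCorrelation (sscm (fun i : Fin n => X i ω) (T n ω)))
      atTop (𝓝 (generalizedCorrelation V))) ∧
    TendstoInDistribution (fun (n : ℕ) ω => √(n : ℝ) *
        (spatialSignCorrelation (sscm (fun i : Fin n => X i ω) (T n ω))
          - generalizedCorrelation V)) atTop (id : ℝ → ℝ) (fun _ => P)
      (gaussianReal 0 (asymptoticVariance (generalizedCorrelation V)
        √(V 0 0 / V 1 1)).toNNReal) := by
  have hV := hF.posDef
  have hζ := norm_signMean_lt_one hV
  obtain ⟨D, hD, hL⟩ := hF.exists_hasLaw_toComplex_sub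
  have hlaw (i : ℕ) : HasLaw (fun ω => toComplex (X i ω - μ)) _ P := hL.comp ⟨hXm i, hXlaw i⟩
  have hprob := (hlaw 0).isProbabilityMeasure_iff.1 inferInstance
  have hind := hXind.comp (fun _ x => toComplex (x - μ)) fun _ => by fun_prop
  have hinv' : Integrable (fun z => ‖z‖⁻¹) (ellipticalMeasure D (signMean V)) := by
    rw [← hL.map_eq, integrable_map_measure (by fun_prop) hL.aemeasurable]
    simpa only [Function.comp_def, LinearIsometryEquiv.norm_map] using hinv
  have hT' (n : ℕ) : ∀ᵐ ω ∂P, ∑ i ∈ Finset.range n,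
      ‖toComplex (X i ω - μ) - toComplex (T n ω - μ)‖
        ≤ ∑ i ∈ Finset.range n, ‖toComplex (X i ω - μ)‖ := by
    simpa [← map_sub, ← Fin.sum_univ_eq_sum_range] using hT n
  have hstat (n : ℕ) (ω : Ω) : spatialSignCorrelation (sscm (fun i : Fin n => X i ω) (T n ω))
      = correlationOfSignMean (sampleMean (fun i =>
        signSq (toComplex (X i ω - μ) - toComplex (T n ω - μ))) n) := by
    simp only [spatialSignCorrelation_sscm n (X · ω), ← map_sub, sub_sub_sub_cancel_right]
  simp only [hstat]
  rw [asymptoticVariance_generalizedCorrelation hV, ← correlationOfSignMean_signMean hV]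
  exact ⟨ae_tendsto_correlationOfSignMean_ellipticalMeasure hD hζ hlaw hind hinv' hT',
    tendstoInDistribution_correlationOfSignMean_ellipticalMeasure hD hζ hlaw hind hinv'
      (fun n => by fun_prop) hT'⟩

theorem proposition3
    {Ω : Type*} [MeasurableSpace Ω] (P : Measure Ω) [IsProbabilityMeasure P]
    (μ : EuclideanSpace ℝ (Fin 2)) (V : Matrix (Fin 2) (Fin 2) ℝ)
    (F : Measure (EuclideanSpace ℝ (Fin 2)))
    (hF : SpatialSign.IsElliptical μ V F)
    (hbdd : SpatialSign.HasBoundedDensityAt F μ)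
    -- an i.i.d. sequence with distribution `F`
    (X : ℕ → Ω → EuclideanSpace ℝ (Fin 2))
    (hXm : ∀ i, AEMeasurable (X i) P)
    (hXind : iIndepFun X P)
    (hXlaw : ∀ i, P.map (X i) = F)
    -- the empirical spatial median of the first `n` observations
    (T : ℕ → Ω → EuclideanSpace ℝ (Fin 2))
    (hTm : ∀ n, AEMeasurable (T n) P)
    (hT : ∀ n, ∀ᵐ ω ∂P, SpatialSign.IsSpatialMedian (fun i : Fin n => X i ω) (T n ω))
    -- the spatial sign correlation of the first `n` observations
    (ρhat : ℕ → Ω → ℝ)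
    (hρhat : ∀ n ω, ρhat n ω = SpatialSign.spatialSignCorrelation
      (SpatialSign.sscm (fun i : Fin n => X i ω) (T n ω)))
    (ρ a : ℝ)
    (hρ : ρ = SpatialSign.generalizedCorrelation V)
    (ha : a = √(V 0 0 / V 1 1)) :
    (∀ᵐ ω ∂P, Tendsto (fun n => ρhat n ω) atTop (𝓝 ρ)) ∧
    TendstoInDistribution (fun (n : ℕ) ω => √(n : ℝ) * (ρhat n ω - ρ)) atTop
      (id : ℝ → ℝ) (fun _ => P)
      (gaussianReal 0 (SpatialSign.asymptoticVariance ρ a).toNNReal) := by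
  obtain rfl : ρhat = _ := funext₂ hρhat
  subst hρ ha
  have := hF.isProbabilityMeasure
  exact proposition3_general P μ V F hF (hbdd.integrable_inv_norm_sub one_lt_two) X hXm hXind hXlaw
    T hTm fun n => (hT n).mono fun ω hω => hω μ
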